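/- Let $\Phi=\{\mathbf e_1,\mathbf e_2,\mathbf e_1-\mathbf e_2,\mathbf e_1+\mathbf e_2\}\subset\mathbb R^2$ (the positive roots of type $B_2$), where $\{\mathbf e_1,\mathbf e_2\}$ is the standard basis of $\mathbb R^2$ with dual basis $\{\mathbf e_1^*,\mathbf e_2^*\}$. For $x$ in the dual space put $$\phi(x)=\frac{1}{8}\sum_{\mathbf s\in\Phi\cup(-\Phi)}e^{i\langle \mathbf s,x\rangle},$$ and for an integer $n\ge 1$ let $$F_n=\sum_{\substack{0\le j,k\le n-1\\(j,k)\ne(0,0)}}\frac{1}{1-\phi\big(\tfrac{2\pi j}{n}\mathbf e_1^*+\tfrac{2\pi k}{n}\mathbf e_2^*\big)} .$$ Then for every $n\ge 1$ $$F_n=\sum_{\substack{0\le j,k\le n-1\\(j,k)\ne(0,0)}}\frac{1}{1-\frac14\left(\cos\frac{2\pi j}{n}+\cos\frac{2\pi k}{n}+\cos\frac{2\pi (j-k)}{n}+\cos\frac{2\pi (j+k)}{n}\right)},$$ and, as $n\to\infty$, $$F_n=\frac{4}{3\pi}\,n^2\log n+\frac{2}{3\pi}\left(2\gamma+\log\frac{96\pi}{\Gamma(1/4)^4}\right)n^2+O(\log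 n),$$ where $\gamma$ is the Euler–Mascheroni constant and $\Gamma$ is the gamma function. -/

import Mathlib

noncomputable section

namespace LatticeSum

variable {V : Type*} [AddCommGroup V] [Module ℝ V]

/-- The function `φ(x) = (1 / (2|Φ|)) ∑_{s ∈ ±Φ} exp (i ⟨s, x⟩)` on the dual space, where
`⟨s, x⟩ = x s` is the duality pairing. Each `s ∈ Φ` contributes one term for `s` and one for
`-s`, so that `φ 0 = 1`. -/
def phi (Φ : Finset V) (x : Module.Dual ℝ V) : ℂ :=
  (1 / (2 * (Φ.card : ℂ))) *
    ∑ s ∈ Φ, (Complex.exp (Complex.I * ((x s : ℝ) : ℂ)) +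
      Complex.exp (Complex.I * ((x (-s) : ℝ) : ℂ)))

/-- The angle `t_j = 2πj/n`. -/
def angle (n j : ℕ) : ℝ := 2 * Real.pi * j / n

/-- The point `x_{j,k} = t_j ß₁ + t_k ß₂`, where `(ß₁, ß₂)` is the basis dual to `b`. -/
def gridPoint (b : Module.Basis (Fin 2) ℝ V) (n j k : ℕ) : Module.Dual ℝ V :=
  angle n j • b.dualBasis 0 + angle n k • b.dualBasis 1

/-- `F_n(Φ) = ∑ 1 / (1 - φ(x_{j,k}))` over `0 ≤ j, k ≤ n - 1` with `(j, k) ≠ (0, 0)`; here `b` is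
a basis, contained in `Φ`, of the lattice that `Φ` generates. -/
def F (Φ : Finset V) (b : Module.Basis (Fin 2) ℝ V) (n : ℕ) : ℂ :=
  ∑ p ∈ (Finset.range n ×ˢ Finset.range n).erase (0, 0),
    1 / (1 - phi Φ (gridPoint b n p.1 p.2))

/-- The standard basis `(e₁, e₂)` of `ℝ²`. -/
def stdBasis : Module.Basis (Fin 2) ℝ (Fin 2 → ℝ) := Pi.basisFun ℝ (Fin 2)

/-- The positive roots `{e₁, e₂, e₁ - e₂, e₁ + e₂}` of type `B₂`. -/
def rootsB2 : Finset (Fin 2 → ℝ) :=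
  {stdBasis 0, stdBasis 1, stdBasis 0 - stdBasis 1, stdBasis 0 + stdBasis 1}

end LatticeSum

end

namespace LatticeSum

open Finset Filter Topology MeasureTheory

/-! ### Trigonometric sums over the `n`-th roots of unity -/

/-! For fixed `j ≠ 0` put `θ = πj/n`, `s = sin θ`, `q = √(1 - s²/3)`. Then `1 - φ` is affine in `cos
t_k`, and equals `(3/8) |(q + s) - (q - s) e^{i t_k}|²`. The Poisson kernel sums exactly over roots
of unity, so row `j` contributes `(2n/3) · 1/(s q) · (1 + 2 rⁿ/(1 - rⁿ))` with `r = (q - s)/(q + s)`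
(`sum_summandB2_row`). Row `0` contributes `2(n² - 1)/9`.

The weights `1/(s q)` are `1/sin` plus a smooth function. The first part gives harmonic numbers,
hence `log n` and `γ`; the second is a Riemann sum with integral `log (3/2)`
(`exists_abs_sum_rowWeight_sub_le`).

In the remaining part only rows near `j = 0` and `j = n` matter. There `1/(s q) ≈ n/(πj)` and `rⁿ ≈
e^{-2πj}`, so the sum is `(4n/π) ∑ 1/(j (e^{2πj} - 1))` up to `O(1/n)`
(`exists_abs_sum_corr_sub_le`).

That series is `-log ∏ (1 - e^{-2πk})`, essentially the Dedekind eta value at `i`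
(`four_mul_expSeries`). The Jacobi triple product expresses the cube of the Euler product through
three theta constants at `e^{-π}`. Duplication formulas and the functional equation reduce these to
one, and the arithmetic-geometric mean evaluates that one as a lemniscatic integral in `Γ(1/4)`. All
errors together are `O(1)`, stronger than the claimed `O(log n)`. -/

lemma exp_angle_mul_I_pow (n k m : ℕ) :
    Complex.exp (Complex.I * (angle n k : ℂ)) ^ m =
      Complex.exp (2 * Real.pi * Complex.I / n) ^ (k * m) := by
  rw [← Complex.exp_nat_mul, ← Complex.exp_nat_mul]
  congr 1
  simp only [angle]
  push_cast
  ring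

lemma sum_exp_angle_pow {n m : ℕ} (hm : 0 < m) (hmn : m < n) :
    ∑ k ∈ range n, Complex.exp (Complex.I * (angle n k : ℂ)) ^ m = 0 := by
  have hζ := Complex.isPrimitiveRoot_exp n (by omega)
  set ζ := Complex.exp (2 * Real.pi * Complex.I / n) with hζdef
  have h1 : ζ ^ m ≠ 1 := hζ.pow_ne_one_of_pos_of_lt hm.ne' hmn
  have h2 : ∑ k ∈ range n, (ζ ^ m) ^ k = 0 := by
    rw [geom_sum_eq h1, ← pow_mul, mul_comm, pow_mul, hζ.pow_eq_one]
    simp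
  rw [← h2]
  refine sum_congr rfl fun k _ => ?_
  rw [exp_angle_mul_I_pow, ← hζdef, ← pow_mul, mul_comm]

lemma re_exp_angle_pow (n k m : ℕ) :
    (Complex.exp (Complex.I * (angle n k : ℂ)) ^ m).re = Real.cos (m * angle n k) := by
  rw [← Complex.exp_nat_mul, show (m : ℂ) * (Complex.I * (angle n k : ℂ)) =
    ((m * angle n k : ℝ) : ℂ) * Complex.I by push_cast; ring, Complex.exp_ofReal_mul_I_re]

lemma sum_cos_mul_angle {n m : ℕ} (hm : 0 < m) (hmn : m < n) :
    ∑ k ∈ range n, Real.cos (m * angle n k) = 0 := by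
  have := congrArg Complex.re (sum_exp_angle_pow hm hmn)
  simpa [Complex.re_sum, re_exp_angle_pow] using this

lemma one_sub_two_mul_cos_add_sq_pos {r : ℝ} (hr : |r| < 1) (t : ℝ) :
    0 < 1 - 2 * r * Real.cos t + r ^ 2 := by
  have h := abs_lt.mp hr
  have h1 := Real.neg_one_le_cos t
  have h2 := Real.cos_le_one t
  rcases le_total 0 r with h0 | h0
  · nlinarith [mul_nonneg h0 (sub_nonneg.2 h2), mul_pos (sub_pos.2 h.2) (sub_pos.2 h.2)]
  · nlinarith [mul_nonneg (neg_nonneg.2 h0) (by linarith : 0 ≤ 1 + Real.cos t),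
      mul_pos (by linarith [h.1] : 0 < 1 + r) (by linarith [h.1] : 0 < 1 + r)]

/-- Real part of the geometric sum of `r z`, with `z = e^{it}`. Since `zⁿ = 1`, truncating at `n`
only costs the factor `1 - rⁿ`. -/
lemma sum_pow_mul_cos_eq {n : ℕ} (hn : 0 < n) {r : ℝ} (hr : |r| < 1) (k : ℕ) :
    ∑ m ∈ range n, r ^ m * Real.cos (m * angle n k) =
      (1 - r ^ n) * ((1 - r * Real.cos (angle n k)) /
        (1 - 2 * r * Real.cos (angle n k) + r ^ 2)) := by
  set t := angle n k with ht
  set z : ℂ := Complex.exp (Complex.I * (t : ℂ)) with hz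
  have hzn : z ^ n = 1 := by
    rw [hz, exp_angle_mul_I_pow, mul_comm k n, pow_mul,
      (Complex.isPrimitiveRoot_exp n hn.ne').pow_eq_one, one_pow]
  have hz' : z = ⟨Real.cos t, Real.sin t⟩ := by
    rw [hz, mul_comm]
    exact Complex.ext (Complex.exp_ofReal_mul_I_re t) (Complex.exp_ofReal_mul_I_im t)
  have hpos := one_sub_two_mul_cos_add_sq_pos hr t
  have hgeom := mul_neg_geom_sum ((r : ℂ) * z) n
  rw [mul_pow, hzn, mul_one] at hgeom
  have hre : ∀ m : ℕ, (((r : ℂ) * z) ^ m).re = r ^ m * Real.cos (m * t) := by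
    intro m
    rw [mul_pow, ← Complex.ofReal_pow, Complex.re_ofReal_mul, hz, re_exp_angle_pow]
  set S : ℂ := ∑ m ∈ range n, ((r : ℂ) * z) ^ m with hS
  have hSre : S.re = ∑ m ∈ range n, r ^ m * Real.cos (m * t) := by
    rw [hS, Complex.re_sum]
    exact sum_congr rfl fun m _ => hre m
  rw [← hSre]
  have e1 := congrArg Complex.re hgeom
  have e2 := congrArg Complex.im hgeom
  rw [← Complex.ofReal_pow] at e1 e2
  simp only [hz', Complex.mul_re, Complex.mul_im, Complex.sub_re, Complex.sub_im, Complex.one_re,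
    Complex.one_im, Complex.ofReal_re, Complex.ofReal_im] at e1 e2
  rw [mul_div_assoc', eq_div_iff hpos.ne']
  -- Real part of `(1 - r z) S = 1 - rⁿ` after multiplication by the conjugate of `1 - r z`.
  linear_combination (1 - r * Real.cos t) * e1 - r * Real.sin t * e2 -
    r ^ 2 * S.re * Real.sin_sq_add_cos_sq t

/-- The Poisson kernel summed over the `n`-th roots of unity. -/
lemma sum_inv_poisson {n : ℕ} (hn : 0 < n) {r : ℝ} (hr : |r| < 1) :
    ∑ k ∈ range n, 1 / (1 - 2 * r * Real.cos (angle n k) + r ^ 2) =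
      n * (1 + r ^ n) / ((1 - r ^ n) * (1 - r ^ 2)) := by
  have hrn : r ^ n < 1 := by
    have := pow_lt_one₀ (abs_nonneg r) hr hn.ne'
    rw [← abs_pow] at this
    exact (le_abs_self _).trans_lt this
  have hr2 : r ^ 2 < 1 := by rw [sq_lt_one_iff_abs_lt_one]; exact hr
  -- By orthogonality only `m = 0` survives the sum over `k`.
  have h1 : ∑ k ∈ range n, ∑ m ∈ range n, r ^ m * Real.cos (m * angle n k) = n := by
    rw [sum_comm]
    obtain ⟨n, rfl⟩ : ∃ l, n = l + 1 := ⟨n - 1, by omega⟩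
    rw [sum_range_succ']
    simp only [pow_zero, Nat.cast_zero, zero_mul, Real.cos_zero, mul_one, sum_const, card_range,
      nsmul_eq_mul]
    rw [sum_eq_zero, zero_add]
    intro m hm
    rw [← mul_sum, sum_cos_mul_angle (by omega) (by simpa using hm), mul_zero]
  simp_rw [sum_pow_mul_cos_eq hn hr, ← mul_sum] at h1
  -- `1/|1 - r z|² = (2 Re (1/(1 - r z)) - 1)/(1 - r²)`.
  have h2 : ∀ k, 1 / (1 - 2 * r * Real.cos (angle n k) + r ^ 2) =
      (2 * ((1 - r * Real.cos (angle n k)) /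
        (1 - 2 * r * Real.cos (angle n k) + r ^ 2)) - 1) / (1 - r ^ 2) := by
    intro k
    have := (one_sub_two_mul_cos_add_sq_pos hr (angle n k)).ne'
    have h3 : (1 - r ^ 2) ≠ 0 := by linarith
    field_simp
    ring
  simp_rw [h2, ← sum_div, sum_sub_distrib, ← mul_sum]
  have h3 : (1 - r ^ 2) ≠ 0 := by linarith
  have h4 : (1 - r ^ n) ≠ 0 := by linarith
  rw [mul_comm] at h1
  rw [eq_div_of_mul_eq h4 h1]
  simp only [sum_const, card_range, nsmul_eq_mul, mul_one]
  field_simp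
  ring

/-! ### The row through the origin -/

lemma cos_angle_lt_one {n k : ℕ} (hk : 0 < k) (hkn : k < n) : Real.cos (angle n k) < 1 := by
  have hn : (0 : ℝ) < n := by exact_mod_cast hk.trans hkn
  have hk' : (0 : ℝ) < k := by exact_mod_cast hk
  have hkn' : (k : ℝ) < n := by exact_mod_cast hkn
  refine lt_of_le_of_ne (Real.cos_le_one _) fun h => ?_
  have h0 : 0 < angle n k := by unfold angle; positivity
  have h1 : angle n k < 2 * Real.pi := by
    unfold angle
    rw [div_lt_iff₀ hn]
    exact mul_lt_mul_of_pos_left hkn' (by positivity)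
  rw [Real.cos_eq_one_iff_of_lt_of_lt (by linarith) h1] at h
  linarith

/-- As a function of `m`, `(1 - cos mt)/(1 - cos t)` has second difference `2 cos mt`. Summed over
`1 ≤ k < n` this is `-2` for `0 < m < n`, which is also the second difference of `m (n - m)`. -/
lemma sum_one_sub_cos_div_one_sub_cos {n m : ℕ} (hm : m ≤ n) :
    ∑ k ∈ Ico 1 n, (1 - Real.cos (m * angle n k)) / (1 - Real.cos (angle n k)) =
      m * (n - m) := by
  have hne : ∀ k ∈ Ico 1 n, 1 - Real.cos (angle n k) ≠ 0 := by
    intro k hk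
    rw [mem_Ico] at hk
    linarith [cos_angle_lt_one hk.1 hk.2]
  -- The recurrence has order two, so the induction carries two consecutive values.
  have key : ∀ m : ℕ, (m ≤ n → ∑ k ∈ Ico 1 n, (1 - Real.cos (m * angle n k)) /
      (1 - Real.cos (angle n k)) = m * (n - m)) ∧ (m + 1 ≤ n → ∑ k ∈ Ico 1 n,
      (1 - Real.cos ((m + 1 : ℕ) * angle n k)) / (1 - Real.cos (angle n k)) =
      (m + 1 : ℕ) * (n - (m + 1 : ℕ))) := by
    intro m
    induction m with
    | zero =>
      refine ⟨fun _ => by simp, fun h => ?_⟩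
      rw [sum_congr rfl (g := fun _ => (1 : ℝ)) fun k hk => by simpa using div_self (hne k hk)]
      simp [Nat.cast_sub h]
    | succ m ih =>
      refine ⟨ih.2, fun h => ?_⟩
      have e0 := ih.1 (by omega)
      have e1 := ih.2 (by omega)
      have e2 : ∑ k ∈ Ico 1 n, Real.cos ((m + 1 : ℕ) * angle n k) = -1 := by
        have := sum_cos_mul_angle (n := n) (m := m + 1) (by omega) (by omega)
        rw [range_eq_Ico, sum_eq_sum_Ico_succ_bot (by omega)] at this
        simp only [angle, Nat.cast_zero, mul_zero, zero_div, Real.cos_zero, zero_add] at this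
        simp only [angle]
        linarith
      have e3 : ∀ k ∈ Ico 1 n, (1 - Real.cos ((m + 1 + 1 : ℕ) * angle n k)) /
          (1 - Real.cos (angle n k)) = 2 * ((1 - Real.cos ((m + 1 : ℕ) * angle n k)) /
          (1 - Real.cos (angle n k))) - (1 - Real.cos (m * angle n k)) /
          (1 - Real.cos (angle n k)) + 2 * Real.cos ((m + 1 : ℕ) * angle n k) := by
        intro k hk
        have hk' := hne k hk
        set t := angle n k
        have c1 : Real.cos ((m + 1 + 1 : ℕ) * t) = Real.cos ((m + 1 : ℕ) * t) * Real.cos t -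
            Real.sin ((m + 1 : ℕ) * t) * Real.sin t := by
          rw [← Real.cos_add]; push_cast; ring_nf
        have c2 : Real.cos (m * t) = Real.cos ((m + 1 : ℕ) * t) * Real.cos t +
            Real.sin ((m + 1 : ℕ) * t) * Real.sin t := by
          rw [← Real.cos_sub]; push_cast; ring_nf
        rw [c1, c2]
        field_simp
        ring
      rw [sum_congr rfl e3, sum_add_distrib, sum_sub_distrib, ← mul_sum, ← mul_sum, e0, e1, e2]
      push_cast
      ring
  exact (key m).1 hm

/-- Sum the preceding formula over `0 ≤ m < n`: for each `k` the cosines cancel, leaving `n` times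
the wanted term. -/
lemma sum_inv_one_sub_cos {n : ℕ} (hn : 0 < n) :
    ∑ k ∈ Ico 1 n, 1 / (1 - Real.cos (angle n k)) = ((n : ℝ) ^ 2 - 1) / 6 := by
  have hn' : (n : ℝ) ≠ 0 := by exact_mod_cast hn.ne'
  have h1 : ∑ m ∈ range n, ∑ k ∈ Ico 1 n,
      (1 - Real.cos (m * angle n k)) / (1 - Real.cos (angle n k)) =
      ∑ m ∈ range n, (m : ℝ) * (n - m) :=
    sum_congr rfl fun m hm => sum_one_sub_cos_div_one_sub_cos (mem_range.1 hm).le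
  have h2 : ∀ N : ℕ, ∑ m ∈ range N, (m : ℝ) * (n - m) =
      n * (N * (N - 1) / 2) - N * (N - 1) * (2 * N - 1) / 6 := by
    intro N
    induction N with
    | zero => simp
    | succ N ih => rw [sum_range_succ, ih]; push_cast; ring
  rw [sum_comm, h2] at h1
  have h3 : ∀ k ∈ Ico 1 n, ∑ m ∈ range n,
      (1 - Real.cos (m * angle n k)) / (1 - Real.cos (angle n k)) =
      n * (1 / (1 - Real.cos (angle n k))) := by
    intro k hk
    rw [mem_Ico] at hk
    have hz : ∑ m ∈ range n, Real.cos (m * angle n k) = 0 := by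
      rw [← sum_cos_mul_angle (n := n) (m := k) (by omega) hk.2]
      refine sum_congr rfl fun m _ => ?_
      simp only [angle]
      ring_nf
    rw [← sum_div, sum_sub_distrib, hz]
    simp [div_eq_mul_inv]
  rw [sum_congr rfl h3, ← mul_sum] at h1
  apply mul_left_cancel₀ hn'
  rw [h1]
  ring

/-! ### The sum as a real trigonometric sum -/

/-- The summand `1 / (1 - φ)` of the `B₂` lattice sum, in terms of cosines. -/
noncomputable def summandB2 (n : ℕ) (p : ℕ × ℕ) : ℝ :=
  1 / (1 - (1 / 4 : ℝ) *
    (Real.cos (2 * Real.pi * (p.1 : ℝ) / n) + Real.cos (2 * Real.pi * (p.2 : ℝ) / n) +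
      Real.cos (2 * Real.pi * ((p.1 : ℝ) - (p.2 : ℝ)) / n) +
      Real.cos (2 * Real.pi * ((p.1 : ℝ) + (p.2 : ℝ)) / n)))

lemma gridPoint_stdBasis_apply (n j k : ℕ) (v : Fin 2 → ℝ) :
    gridPoint stdBasis n j k v = angle n j * v 0 + angle n k * v 1 := by
  simp [gridPoint, stdBasis]

lemma exp_add_exp_neg_eq_two_cos (t : ℝ) :
    Complex.exp (Complex.I * (t : ℂ)) + Complex.exp (Complex.I * ((-t : ℝ) : ℂ)) =
      ((2 * Real.cos t : ℝ) : ℂ) := by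
  push_cast
  rw [Complex.two_cos]
  ring_nf

lemma stdBasis_zero : stdBasis 0 = ![1, 0] := by
  ext i; fin_cases i <;> simp [stdBasis]

lemma stdBasis_one : stdBasis 1 = ![0, 1] := by
  ext i; fin_cases i <;> simp [stdBasis]

lemma rootsB2_eq : rootsB2 = {![1, 0], ![0, 1], ![1, -1], ![1, 1]} := by
  simp [rootsB2, stdBasis_zero, stdBasis_one]

lemma phi_rootsB2 (n j k : ℕ) :
    phi rootsB2 (gridPoint stdBasis n j k) = (((1 / 4 : ℝ) *
      (Real.cos (2 * Real.pi * (j : ℝ) / n) + Real.cos (2 * Real.pi * (k : ℝ) / n) +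
      Real.cos (2 * Real.pi * ((j : ℝ) - (k : ℝ)) / n) +
      Real.cos (2 * Real.pi * ((j : ℝ) + (k : ℝ)) / n)) : ℝ) : ℂ) := by
  have h1 : (![1, 0] : Fin 2 → ℝ) ∉ ({![0, 1], ![1, -1], ![1, 1]} : Finset (Fin 2 → ℝ)) := by
    simp
  have h2 : (![0, 1] : Fin 2 → ℝ) ∉ ({![1, -1], ![1, 1]} : Finset (Fin 2 → ℝ)) := by
    simp
  have h3 : (![1, -1] : Fin 2 → ℝ) ∉ ({![1, 1]} : Finset (Fin 2 → ℝ)) := by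
    simp; norm_num
  have hcard : rootsB2.card = 4 := by
    rw [rootsB2_eq, card_insert_of_notMem h1, card_insert_of_notMem h2, card_insert_of_notMem h3,
      card_singleton]
  rw [phi, hcard, rootsB2_eq, sum_insert h1, sum_insert h2, sum_insert h3, sum_singleton]
  simp only [map_neg, exp_add_exp_neg_eq_two_cos, gridPoint_stdBasis_apply]
  simp only [Matrix.cons_val_zero, Matrix.cons_val_one]
  have e1 : angle n j * 1 + angle n k * 0 = 2 * Real.pi * (j : ℝ) / n := by
    simp [angle]
  have e2 : angle n j * 0 + angle n k * 1 = 2 * Real.pi * (k : ℝ) / n := by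
    simp [angle]
  have e3 : angle n j * 1 + angle n k * (-1) = 2 * Real.pi * ((j : ℝ) - k) / n := by
    simp only [angle]; ring
  have e4 : angle n j * 1 + angle n k * 1 = 2 * Real.pi * ((j : ℝ) + k) / n := by
    simp only [angle]; ring
  rw [e1, e2, e3, e4]
  push_cast
  ring

lemma F_rootsB2_eq (n : ℕ) :
    F rootsB2 stdBasis n =
      ((∑ p ∈ (range n ×ˢ range n).erase (0, 0), summandB2 n p : ℝ) : ℂ) := by
  rw [F, Complex.ofReal_sum]
  refine sum_congr rfl fun p _ => ?_
  rw [phi_rootsB2, summandB2]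
  push_cast
  rfl

/-! ### Summation along a row -/

/-- The factor `√(1 - sin² θ / 3)`. -/
noncomputable def rowRoot (θ : ℝ) : ℝ := √(1 - Real.sin θ ^ 2 / 3)

/-- The weight of the row with angle `2 θ`. -/
noncomputable def rowWeight (θ : ℝ) : ℝ := 1 / (Real.sin θ * rowRoot θ)

/-- The root of modulus less than `1` of the quadratic attached to the row with angle `2 θ`. -/
noncomputable def rowRatio (θ : ℝ) : ℝ := (rowRoot θ - Real.sin θ) / (rowRoot θ + Real.sin θ)

lemma rowRoot_sq (θ : ℝ) : rowRoot θ ^ 2 = 1 - Real.sin θ ^ 2 / 3 := by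
  rw [rowRoot, Real.sq_sqrt]
  nlinarith [Real.sin_sq_le_one θ]

lemma rowRoot_pos (θ : ℝ) : 0 < rowRoot θ := by
  rw [rowRoot, Real.sqrt_pos]
  nlinarith [Real.sin_sq_le_one θ]

lemma abs_rowRatio_lt_one {θ : ℝ} (h : 0 < Real.sin θ) : |rowRatio θ| < 1 := by
  have hq := rowRoot_pos θ
  rw [rowRatio, abs_div, abs_of_pos (a := rowRoot θ + _) (by linarith), div_lt_one (by linarith),
    abs_lt]
  constructor <;> linarith

lemma sin_pi_mul_div_pos {n j : ℕ} (hj : 0 < j) (hjn : j < n) :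
    0 < Real.sin (Real.pi * j / n) := by
  have hn : (0 : ℝ) < n := by exact_mod_cast hj.trans hjn
  have hj' : (0 : ℝ) < j := by exact_mod_cast hj
  have hjn' : (j : ℝ) < n := by exact_mod_cast hjn
  refine Real.sin_pos_of_pos_of_lt_pi (by positivity) ?_
  rw [div_lt_iff₀ hn]
  exact mul_lt_mul_of_pos_left hjn' Real.pi_pos

/-- Here `1 - φ = (3/4 + s²/2) - (3/4 - s²) cos t`, and `q` is chosen so that the two coefficients
are `(3/8)((q + s)² + (q - s)²)` and `(3/4)(q + s)(q - s)`. The ratio `r` may be negative, so only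
`|r| < 1` is used. -/
lemma sum_summandB2_row {n j : ℕ} (hj : 0 < j) (hjn : j < n) :
    ∑ k ∈ range n, summandB2 n (j, k) = 2 / 3 * n * rowWeight (Real.pi * j / n) *
      (1 + 2 * rowRatio (Real.pi * j / n) ^ n / (1 - rowRatio (Real.pi * j / n) ^ n)) := by
  set θ := Real.pi * j / n with hθ
  have hs : 0 < Real.sin θ := sin_pi_mul_div_pos hj hjn
  have hq := rowRoot_pos θ
  have hq2 := rowRoot_sq θ
  have hr := abs_rowRatio_lt_one hs
  set s := Real.sin θ with hsdef
  set q := rowRoot θ with hqdef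
  set r := rowRatio θ
  have hrdef : r = (q - s) / (q + s) := rfl
  have hn : 0 < n := hj.trans hjn
  have hterm : ∀ k ∈ range n, summandB2 n (j, k) =
      8 / (3 * (q + s) ^ 2) * (1 / (1 - 2 * r * Real.cos (angle n k) + r ^ 2)) := by
    intro k _
    have hpos := one_sub_two_mul_cos_add_sq_pos hr (angle n k)
    have hr' : r * (q + s) = q - s := by
      rw [hrdef]; field_simp
    have hcos : Real.cos (2 * Real.pi * (j : ℝ) / n) = 1 - 2 * s ^ 2 := by
      rw [show 2 * Real.pi * (j : ℝ) / n = 2 * θ by rw [hθ]; ring, Real.cos_two_mul, hsdef,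
        Real.sin_sq]
      ring
    have h1 : Real.cos (2 * Real.pi * ((j : ℝ) - (k : ℝ)) / n) +
        Real.cos (2 * Real.pi * ((j : ℝ) + (k : ℝ)) / n) =
        2 * (1 - 2 * s ^ 2) * Real.cos (angle n k) := by
      rw [show 2 * Real.pi * ((j : ℝ) - (k : ℝ)) / n = 2 * Real.pi * (j : ℝ) / n - angle n k by
        simp only [angle]; ring, show 2 * Real.pi * ((j : ℝ) + (k : ℝ)) / n =
        2 * Real.pi * (j : ℝ) / n + angle n k by simp only [angle]; ring, Real.cos_sub,
        Real.cos_add, hcos]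
      ring
    have h2 : 1 - (1 / 4 : ℝ) *
        (Real.cos (2 * Real.pi * (j : ℝ) / n) + Real.cos (2 * Real.pi * (k : ℝ) / n) +
        Real.cos (2 * Real.pi * ((j : ℝ) - (k : ℝ)) / n) +
        Real.cos (2 * Real.pi * ((j : ℝ) + (k : ℝ)) / n)) =
        3 * (q + s) ^ 2 / 8 * (1 - 2 * r * Real.cos (angle n k) + r ^ 2) := by
      rw [add_assoc _ (Real.cos (2 * Real.pi * ((j : ℝ) - (k : ℝ)) / n)), h1, hcos]
      change 1 - 1 / 4 * (1 - 2 * s ^ 2 + Real.cos (angle n k) + _) = _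
      have : 3 * (q + s) ^ 2 / 8 * (1 - 2 * r * Real.cos (angle n k) + r ^ 2) =
          3 / 8 * ((q + s) ^ 2 - 2 * (r * (q + s)) * (q + s) * Real.cos (angle n k) +
            (r * (q + s)) ^ 2) := by ring
      rw [this, hr']
      linear_combination (3 / 4 * Real.cos (angle n k) - 3 / 4) * hq2
    rw [summandB2]
    simp only
    rw [h2]
    field_simp
  rw [sum_congr rfl hterm, ← mul_sum, sum_inv_poisson hn hr]
  have hrn : r ^ n < 1 := by
    have := pow_lt_one₀ (abs_nonneg r) hr hn.ne'
    rw [← abs_pow] at this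
    exact (le_abs_self _).trans_lt this
  have hrn' : 1 - r ^ n ≠ 0 := by linarith
  have hr2 : 1 - r ^ 2 = 4 * q * s / (q + s) ^ 2 := by
    rw [hrdef]
    field_simp
    ring
  rw [hr2, rowWeight]
  rw [← hsdef, ← hqdef]
  field_simp
  ring

lemma sum_summandB2_zero_row {n : ℕ} (hn : 0 < n) :
    ∑ k ∈ Ico 1 n, summandB2 n (0, k) = 2 * ((n : ℝ) ^ 2 - 1) / 9 := by
  have h : ∀ k ∈ Ico 1 n, summandB2 n (0, k) = 4 / 3 * (1 / (1 - Real.cos (angle n k))) := by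
    intro k hk
    rw [mem_Ico] at hk
    have hc := cos_angle_lt_one hk.1 hk.2
    have hc' : 1 - Real.cos (angle n k) ≠ 0 := by linarith
    have e : 2 * Real.pi * (0 - (k : ℝ)) / n = -angle n k := by simp only [angle]; ring
    have e' : 2 * Real.pi * (k : ℝ) / n = angle n k := rfl
    simp only [summandB2, Nat.cast_zero, mul_zero, zero_div, Real.cos_zero, zero_add, e, e',
      Real.cos_neg]
    rw [show 1 - 1 / 4 * (1 + Real.cos (angle n k) + Real.cos (angle n k) +
      Real.cos (angle n k)) = 3 / 4 * (1 - Real.cos (angle n k)) by ring]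
    field_simp
  rw [sum_congr rfl h, ← mul_sum, sum_inv_one_sub_cos hn]
  ring

/-- The lattice sum after exact summation along the rows. -/
lemma sum_summandB2_eq {n : ℕ} (hn : 0 < n) :
    ∑ p ∈ (range n ×ˢ range n).erase (0, 0), summandB2 n p =
      2 * ((n : ℝ) ^ 2 - 1) / 9 + 2 / 3 * n * ∑ j ∈ Ico 1 n, rowWeight (Real.pi * j / n) +
      2 / 3 * n * ∑ j ∈ Ico 1 n, rowWeight (Real.pi * j / n) *
        (2 * rowRatio (Real.pi * j / n) ^ n / (1 - rowRatio (Real.pi * j / n) ^ n)) := by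
  have h0 : ((0, 0) : ℕ × ℕ) ∈ range n ×ˢ range n := by simp [hn]
  have h1 : ∑ p ∈ (range n ×ˢ range n).erase (0, 0), summandB2 n p =
      ∑ k ∈ Ico 1 n, summandB2 n (0, k) +
        ∑ j ∈ Ico 1 n, ∑ k ∈ range n, summandB2 n (j, k) := by
    have h2 := add_sum_erase (range n ×ˢ range n) (summandB2 n) h0
    rw [sum_product] at h2
    rw [range_eq_Ico, sum_eq_sum_Ico_succ_bot hn, sum_eq_sum_Ico_succ_bot hn] at h2
    simp only [zero_add] at h2
    rw [range_eq_Ico]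
    linarith
  rw [h1, sum_summandB2_zero_row hn, add_assoc, mul_sum, mul_sum, ← sum_add_distrib]
  congr 1
  refine sum_congr rfl fun j hj => ?_
  rw [mem_Ico] at hj
  rw [sum_summandB2_row hj.1 hj.2]
  ring

/-! ### Harmonic numbers to second order -/

/-- This is `y ≤ sinh y` at `y = log ((x + 1)/x)`. -/
lemma log_add_one_sub_log_le {x : ℝ} (hx : 0 < x) :
    Real.log (x + 1) - Real.log x ≤ (1 / x + 1 / (x + 1)) / 2 := by
  have h0 : 0 ≤ Real.log ((x + 1) / x) := Real.log_nonneg (by rw [le_div_iff₀ hx]; linarith)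
  have h := Real.self_le_sinh_iff.2 h0
  rw [Real.sinh_eq, Real.exp_neg, Real.exp_log (by positivity), inv_div,
    Real.log_div (by positivity) (by positivity)] at h
  refine h.trans (le_of_eq ?_)
  field_simp
  ring

/-- First term of the series of positive terms for `log (1 + 1/x)` in odd powers of `1/(2x + 1)`. -/
lemma le_log_add_one_sub_log {x : ℝ} (hx : 0 < x) :
    2 / (2 * x + 1) ≤ Real.log (x + 1) - Real.log x := by
  have h := Real.hasSum_log_one_add_inv hx
  have h1 := le_hasSum h 0 (fun k _ => by positivity)
  rw [← Real.log_div (by positivity) (by positivity), show (x + 1) / x = 1 + x⁻¹ by field_simp]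
  refine le_trans (le_of_eq ?_) h1
  norm_num
  ring

/-- With `e = H - log - 1/(2n)`, the upper bound on `log (x + 1) - log x` makes `e` increase to `γ`,
and the lower bound makes `e + 1/n²` decrease to `γ`. -/
lemma abs_harmonic_sub_le {n : ℕ} (hn : 0 < n) :
    |(harmonic n : ℝ) - Real.log n - 1 / (2 * n) - Real.eulerMascheroniConstant| ≤
      1 / (n : ℝ) ^ 2 := by
  set e : ℕ → ℝ := fun n => (harmonic (n + 1) : ℝ) - Real.log (n + 1 : ℕ) -
    1 / (2 * (n + 1 : ℕ)) with he
  have hinv : Tendsto (fun n : ℕ => 1 / ((n : ℝ) + 1)) atTop (𝓝 0) :=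
    tendsto_one_div_add_atTop_nhds_zero_nat
  have hlim : Tendsto e atTop (𝓝 Real.eulerMascheroniConstant) := by
    have h1 := (tendsto_add_atTop_iff_nat 1).2 Real.tendsto_harmonic_sub_log
    have h2 := h1.sub (hinv.const_mul (1 / 2))
    rw [mul_zero, sub_zero] at h2
    refine h2.congr fun n => ?_
    simp only [he]
    push_cast
    field_simp
  have hstep : ∀ n : ℕ, e (n + 1) - e n = (1 / ((n : ℝ) + 1) + 1 / ((n : ℝ) + 1 + 1)) / 2 -
      (Real.log ((n : ℝ) + 1 + 1) - Real.log ((n : ℝ) + 1)) := by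
    intro n
    simp only [he]
    rw [harmonic_succ (n + 1)]
    push_cast
    field_simp
    ring
  have hmono : Monotone e := by
    refine monotone_nat_of_le_succ fun n => ?_
    have := log_add_one_sub_log_le (x := (n : ℝ) + 1) (by positivity)
    linarith [hstep n]
  have hanti : Antitone fun n => e n + 1 / ((n : ℝ) + 1) ^ 2 := by
    refine antitone_nat_of_succ_le fun n => ?_
    have h1 := le_log_add_one_sub_log (x := (n : ℝ) + 1) (by positivity)
    have h2 : (1 / ((n : ℝ) + 1) + 1 / ((n : ℝ) + 1 + 1)) / 2 - 2 / (2 * ((n : ℝ) + 1) + 1) ≤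
        1 / ((n : ℝ) + 1) ^ 2 - 1 / ((n : ℝ) + 1 + 1) ^ 2 := by
      set x : ℝ := (n : ℝ) + 1 with hx
      have hx0 : 0 < x := by positivity
      have e1 : (1 / x + 1 / (x + 1)) / 2 - 2 / (2 * x + 1) =
          1 / (2 * x * (x + 1) * (2 * x + 1)) := by
        field_simp
        ring
      have e2 : 1 / x ^ 2 - 1 / (x + 1) ^ 2 = (2 * x + 1) / (x ^ 2 * (x + 1) ^ 2) := by
        field_simp
        ring
      rw [e1, e2, div_le_div_iff₀ (by positivity) (by positivity)]
      have : 0 ≤ x * (x + 1) * (7 * x ^ 2 + 7 * x + 2) := by positivity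
      nlinarith
    push_cast
    linarith [hstep n]
  have hlim' : Tendsto (fun n => e n + 1 / ((n : ℝ) + 1) ^ 2) atTop
      (𝓝 Real.eulerMascheroniConstant) := by
    have := hlim.add (hinv.pow 2)
    simpa using this
  obtain ⟨m, rfl⟩ : ∃ m, n = m + 1 := ⟨n - 1, by omega⟩
  have h1 := hmono.ge_of_tendsto hlim m
  have h2 := hanti.le_of_tendsto hlim' m
  simp only [he] at h1 h2
  rw [abs_le]
  push_cast at h1 h2 ⊢
  constructor <;> linarith [show 0 ≤ 1 / ((m : ℝ) + 1) ^ 2 by positivity]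

/-! ### The trapezoidal rule -/

/-- The `C²` error bound of the trapezoidal rule, multiplied by `n/b`; the endpoint terms move to
the main part because the row sums omit them. -/
lemma exists_abs_sum_sub_integral_le {f : ℝ → ℝ} {b : ℝ} (hb : 0 < b)
    (hf : ContDiffOn ℝ 2 f (Set.Icc 0 b)) :
    ∃ C : ℝ, ∀ n : ℕ, 0 < n → |∑ j ∈ Ico 1 n, f (b * j / n) -
      (n / b * (∫ x in (0 : ℝ)..b, f x) - (f 0 + f b) / 2)| ≤ C / n := by
  have hu : Set.uIcc 0 b = Set.Icc 0 b := Set.uIcc_of_le hb.le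
  have hcont : ContinuousOn (iteratedDerivWithin 2 f (Set.Icc 0 b)) (Set.Icc 0 b) :=
    hf.continuousOn_iteratedDerivWithin le_rfl (uniqueDiffOn_Icc hb)
  obtain ⟨M, hM⟩ := isCompact_Icc.exists_bound_of_continuousOn hcont
  -- The bound is needed for every real `x`; off the closed interval the derivative within it takes
  -- the default value `0`.
  have hM' : ∀ x, |iteratedDerivWithin 2 f (Set.uIcc 0 b) x| ≤ max M 0 := by
    intro x
    rw [hu]
    by_cases hx : x ∈ Set.Icc 0 b
    · exact (hM x hx).trans (le_max_left _ _)
    · rw [iteratedDerivWithin_succ, derivWithin_zero_of_notMem_closure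
        (by rwa [isClosed_Icc.closure_eq]), abs_zero]
      exact le_max_right _ _
  refine ⟨b ^ 2 * max M 0 / 12, fun n hn => ?_⟩
  have hn' : (0 : ℝ) < n := by exact_mod_cast hn
  have h := trapezoidal_error_le_of_c2 (by rwa [hu]) hM' hn
  rw [trapezoidal_error, trapezoidal_integral, sub_zero, abs_of_pos hb] at h
  have hsum : ∑ k ∈ range (n - 1), f (0 + (k + 1) * b / n) = ∑ j ∈ Ico 1 n, f (b * j / n) := by
    rw [sum_Ico_eq_sum_range]
    refine sum_congr rfl fun k _ => ?_
    push_cast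
    ring_nf
  rw [hsum] at h
  set S := ∑ j ∈ Ico 1 n, f (b * j / n)
  set I := ∫ x in (0 : ℝ)..b, f x
  have e : S - (n / b * I - (f 0 + f b) / 2) = n / b * (b / n * ((f 0 + f b) / 2 + S) - I) := by
    field_simp
    ring
  rw [e, abs_mul, abs_of_pos (by positivity : 0 < n / b)]
  refine (mul_le_mul_of_nonneg_left h (by positivity)).trans (le_of_eq ?_)
  field_simp

/-! ### The sum of `1 / sin` over equally spaced points -/

/-- At `a` the power series is shifted by one; elsewhere the function is locally a quotient of
analytic functions. -/
lemma analyticAt_dslope {f : ℝ → ℝ} {a x : ℝ} (ha : AnalyticAt ℝ f a) (hx : AnalyticAt ℝ f x) :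
    AnalyticAt ℝ (dslope f a) x := by
  rcases eq_or_ne x a with rfl | h
  · obtain ⟨p, hp⟩ := ha
    exact ⟨_, hp.has_fpower_series_dslope_fslope⟩
  · refine AnalyticAt.congr ?_ (dslope_eventuallyEq_slope_of_ne f h).symm
    have : slope f a = fun y => (y - a)⁻¹ * (f y - f a) := by
      ext y; simp [slope, vsub_eq_sub]
    rw [this]
    exact ((analyticAt_id.sub analyticAt_const).inv (sub_ne_zero.2 h)).mul
      (hx.sub analyticAt_const)

lemma analyticAt_sinc (x : ℝ) : AnalyticAt ℝ Real.sinc x := by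
  rw [Real.sinc_eq_dslope]
  exact analyticAt_dslope Real.analyticAt_sin Real.analyticAt_sin

lemma sinc_pos {x : ℝ} (h0 : 0 ≤ x) (hx : x < Real.pi) : 0 < Real.sinc x := by
  rcases h0.eq_or_lt with rfl | h
  · simp
  · rw [Real.sinc_of_ne_zero h.ne']
    exact div_pos (Real.sin_pos_of_pos_of_lt_pi h hx) h

/-- The function `cot x - 1 / x`, extended by continuity to `0`. -/
noncomputable def cotSubInv : ℝ → ℝ := dslope (fun x => Real.cos x / Real.sinc x) 0

lemma analyticAt_cotSubInv {x : ℝ} (h0 : 0 ≤ x) (hx : x < Real.pi) :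
    AnalyticAt ℝ cotSubInv x := by
  refine analyticAt_dslope ?_ ?_
  · exact Real.analyticAt_cos.div (analyticAt_sinc 0) (by simp)
  · exact Real.analyticAt_cos.div (analyticAt_sinc x) (sinc_pos h0 hx).ne'

/-- `cos x / sinc x = x cot x` equals `1` at `0`, so its divided difference is `(x cot x - 1)/x`. -/
lemma cotSubInv_of_pos {x : ℝ} (h0 : 0 < x) (hx : x < Real.pi) :
    cotSubInv x = Real.cos x / Real.sin x - 1 / x := by
  have hs := Real.sin_pos_of_pos_of_lt_pi h0 hx
  rw [cotSubInv, dslope_of_ne _ h0.ne', slope_def_field, Real.sinc_of_ne_zero h0.ne']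
  simp only [Real.cos_zero, Real.sinc_zero, sub_zero]
  field_simp

/-- The value is the derivative at `0` of an even function. -/
lemma cotSubInv_zero : cotSubInv 0 = 0 := by
  rw [cotSubInv, dslope_same]
  have h := deriv_comp_neg (fun x => Real.cos x / Real.sinc x) 0
  simp only [Real.cos_neg, Real.sinc_neg, neg_zero] at h
  linarith

/-- The antiderivative is `log (sin x / x)`, written with `sinc` so that it is continuous at `0`. -/
lemma integral_cotSubInv :
    ∫ x in (0 : ℝ)..(Real.pi / 2), cotSubInv x = Real.log (2 / Real.pi) := by
  have hpi := Real.pi_pos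
  have hcont : ContinuousOn cotSubInv (Set.Icc 0 (Real.pi / 2)) := fun x hx =>
    (analyticAt_cotSubInv hx.1 (by linarith [hx.2])).continuousAt.continuousWithinAt
  rw [intervalIntegral.integral_eq_sub_of_hasDerivAt_of_le (by positivity)
    (f := fun x => Real.log (Real.sinc x))]
  · rw [Real.sinc_of_ne_zero (by positivity)]
    simp
  · intro x hx
    exact (((analyticAt_sinc x).continuousAt).log
      (sinc_pos hx.1 (by linarith [hx.2])).ne').continuousWithinAt
  · intro x hx
    have hx1 : x < Real.pi := by linarith [hx.2]
    have hs := Real.sin_pos_of_pos_of_lt_pi hx.1 hx1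
    have hx0 : 0 < x := hx.1
    have h1 : HasDerivAt (fun y => Real.log (Real.sin y) - Real.log y)
        (Real.cos x / Real.sin x - 1 / x) x := by
      have := ((Real.hasDerivAt_sin x).log hs.ne').sub (Real.hasDerivAt_log hx0.ne')
      rw [one_div]
      exact this
    rw [cotSubInv_of_pos hx0 hx1]
    refine h1.congr_of_eventuallyEq ?_
    filter_upwards [Ioo_mem_nhds hx0 hx1] with y hy
    rw [Real.sinc_of_ne_zero hy.1.ne', Real.log_div
      (Real.sin_pos_of_pos_of_lt_pi hy.1 hy.2).ne' hy.1.ne']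
  · rw [intervalIntegrable_iff_integrableOn_Icc_of_le (by positivity)]
    exact hcont.integrableOn_Icc

lemma sum_Ico_one_reflect (f : ℕ → ℝ) (n : ℕ) :
    ∑ j ∈ Ico 1 n, f (n - j) = ∑ j ∈ Ico 1 n, f j := by
  rcases Nat.eq_zero_or_pos n with rfl | hn
  · simp
  have := sum_Ico_reflect f 1 (m := n) (n := n) (by omega)
  simpa using this

/-- `cot x = 1/sin 2x + cot 2x`, and `cot (πj/n)` is odd under `j ↦ n - j`. The gain is that only
one end of the interval stays singular. -/
lemma sum_inv_sin_eq_sum_cot {n : ℕ} :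
    ∑ j ∈ Ico 1 n, 1 / Real.sin (Real.pi * j / n) =
      ∑ j ∈ Ico 1 n, Real.cos (Real.pi / 2 * j / n) / Real.sin (Real.pi / 2 * j / n) := by
  have hcot : ∑ j ∈ Ico 1 n, Real.cos (Real.pi * j / n) / Real.sin (Real.pi * j / n) = 0 := by
    have h := sum_Ico_one_reflect
      (fun j => Real.cos (Real.pi * j / n) / Real.sin (Real.pi * j / n)) n
    have h2 : ∑ j ∈ Ico 1 n, Real.cos (Real.pi * (n - j : ℕ) / n) /
        Real.sin (Real.pi * (n - j : ℕ) / n) =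
        ∑ j ∈ Ico 1 n, -(Real.cos (Real.pi * j / n) / Real.sin (Real.pi * j / n)) := by
      refine sum_congr rfl fun j hj => ?_
      rw [mem_Ico] at hj
      have hn : (n : ℝ) ≠ 0 := by exact_mod_cast (by omega : n ≠ 0)
      rw [Nat.cast_sub hj.2.le, show Real.pi * ((n : ℝ) - j) / n = Real.pi - Real.pi * j / n by
        field_simp, Real.cos_pi_sub, Real.sin_pi_sub, neg_div]
    rw [h2, sum_neg_distrib] at h
    linarith
  have h3 : ∀ j ∈ Ico 1 n, Real.cos (Real.pi / 2 * j / n) / Real.sin (Real.pi / 2 * j / n) =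
      1 / Real.sin (Real.pi * j / n) +
        Real.cos (Real.pi * j / n) / Real.sin (Real.pi * j / n) := by
    intro j hj
    rw [mem_Ico] at hj
    have hs := sin_pi_mul_div_pos hj.1 hj.2
    set x := Real.pi / 2 * j / n with hx
    have h2x : Real.pi * j / n = 2 * x := by rw [hx]; ring
    rw [h2x] at hs ⊢
    rw [Real.sin_two_mul] at hs ⊢
    have h1 : Real.sin x ≠ 0 := by rintro h; simp [h] at hs
    have h2 : Real.cos x ≠ 0 := by rintro h; simp [h] at hs
    rw [Real.cos_two_mul]
    field_simp
    ring
  rw [sum_congr rfl h3, sum_add_distrib, hcot, add_zero]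

lemma exists_abs_sum_inv_sin_sub_le :
    ∃ C : ℝ, ∀ n : ℕ, 0 < n → |∑ j ∈ Ico 1 n, 1 / Real.sin (Real.pi * j / n) -
      2 * n / Real.pi * (Real.log n + Real.eulerMascheroniConstant + Real.log (2 / Real.pi))| ≤
        C / n := by
  have hpi := Real.pi_pos
  obtain ⟨C, hC⟩ := exists_abs_sum_sub_integral_le (b := Real.pi / 2) (by positivity)
    (f := cotSubInv) (fun x hx =>
      (analyticAt_cotSubInv hx.1 (by linarith [hx.2])).contDiffAt.contDiffWithinAt)
  refine ⟨C + 1, fun n hn => ?_⟩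
  have hn' : (0 : ℝ) < n := by exact_mod_cast hn
  have h1 := hC n hn
  have hend : cotSubInv (Real.pi / 2) = -(2 / Real.pi) := by
    rw [cotSubInv_of_pos (by positivity) (by linarith)]
    simp
  rw [integral_cotSubInv, cotSubInv_zero, hend] at h1
  have h2 := abs_harmonic_sub_le hn
  have h3 : ∑ j ∈ Ico 1 n, (1 : ℝ) / j = harmonic n - 1 / n := by
    rw [harmonic_eq_sum_Icc, ← Finset.Ico_succ_right_eq_Icc, Order.succ_eq_add_one,
      sum_Ico_succ_top hn]
    push_cast
    simp
  have h4 : ∑ j ∈ Ico 1 n, 1 / Real.sin (Real.pi * j / n) =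
      2 * n / Real.pi * (harmonic n - 1 / n) +
        ∑ j ∈ Ico 1 n, cotSubInv (Real.pi / 2 * j / n) := by
    rw [sum_inv_sin_eq_sum_cot, ← h3, mul_sum, ← sum_add_distrib]
    refine sum_congr rfl fun j hj => ?_
    rw [mem_Ico] at hj
    have hj' : (0 : ℝ) < j := by exact_mod_cast hj.1
    have hjn' : (j : ℝ) < n := by exact_mod_cast hj.2
    rw [cotSubInv_of_pos (by positivity)]
    · field_simp
      ring
    · rw [div_lt_iff₀ hn']
      nlinarith
  rw [h4]
  set S := ∑ j ∈ Ico 1 n, cotSubInv (Real.pi / 2 * j / n)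
  -- The constant terms cancel: `(2n/π)(1/(2n) - 1/n) = -1/π` against the endpoint correction
  -- `+1/π`. A surviving constant would become a term of order `n` in `F_n`.
  have e : 2 * n / Real.pi * ((harmonic n : ℝ) - 1 / n) + S - 2 * n / Real.pi *
      (Real.log n + Real.eulerMascheroniConstant + Real.log (2 / Real.pi)) =
      (S - (n / (Real.pi / 2) * Real.log (2 / Real.pi) - (0 + -(2 / Real.pi)) / 2)) +
      2 * n / Real.pi * ((harmonic n : ℝ) - Real.log n - 1 / (2 * n) -
        Real.eulerMascheroniConstant) := by
    field_simp
    ring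
  rw [e, add_div C]
  refine (abs_add_le _ _).trans (add_le_add h1 ?_)
  rw [abs_mul, abs_of_pos (by positivity)]
  refine (mul_le_mul_of_nonneg_left h2 (by positivity)).trans ?_
  rw [show 2 * (n : ℝ) / Real.pi * (1 / (n : ℝ) ^ 2) = (2 / Real.pi) * (1 / n) by field_simp]
  refine mul_le_of_le_one_left (by positivity) ?_
  rw [div_le_one hpi]
  linarith [Real.pi_gt_three]

/-! ### The sum of the row weights -/

/-- The difference `rowWeight - 1 / sin`, as a smooth function. -/
noncomputable def smoothWeight (θ : ℝ) : ℝ := Real.sin θ / (3 * rowRoot θ * (1 + rowRoot θ))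

lemma contDiff_rowRoot : ContDiff ℝ 2 rowRoot := by
  unfold rowRoot
  refine ContDiff.sqrt (by fun_prop) fun θ => ?_
  nlinarith [Real.sin_sq_le_one θ]

lemma contDiff_smoothWeight : ContDiff ℝ 2 smoothWeight := by
  unfold smoothWeight
  refine Real.contDiff_sin.div ((contDiff_const.mul contDiff_rowRoot).mul
    (contDiff_const.add contDiff_rowRoot)) fun θ => ?_
  have := rowRoot_pos θ
  positivity

/-- `1/(s q) - 1/s = (1 - q²)/(s q (1 + q))`, and `1 - q² = s²/3` removes the pole. -/
lemma rowWeight_eq {θ : ℝ} (h : 0 < Real.sin θ) :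
    rowWeight θ = 1 / Real.sin θ + smoothWeight θ := by
  have hq := rowRoot_pos θ
  rw [rowWeight, smoothWeight]
  field_simp
  linear_combination (-3) * rowRoot_sq θ

/-- The antiderivative `log (1 + cos) - log (q + cos)` degenerates at `π`, where both arguments
vanish; hence the half interval, doubled afterwards by symmetry. -/
lemma integral_smoothWeight_half :
    ∫ x in (0 : ℝ)..(Real.pi / 2), smoothWeight x = 1 / 2 * Real.log (3 / 2) := by
  have hpi := Real.pi_pos
  have hcpos : ∀ x ∈ Set.Icc 0 (Real.pi / 2), 0 ≤ Real.cos x := fun x hx =>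
    Real.cos_nonneg_of_mem_Icc ⟨by linarith [hx.1], hx.2⟩
  have hroot0 : rowRoot 0 = 1 := by simp [rowRoot]
  have hroot1 : rowRoot (Real.pi / 2) = √(2 / 3) := by
    rw [rowRoot, Real.sin_pi_div_two]; norm_num
  have hder : ∀ x ∈ Set.uIcc 0 (Real.pi / 2), HasDerivAt
      (fun x => Real.log (1 + Real.cos x) - Real.log (rowRoot x + Real.cos x))
      (smoothWeight x) x := by
    intro x hx
    rw [Set.uIcc_of_le (by positivity)] at hx
    have hc := hcpos x hx
    have hq := rowRoot_pos x
    have hq2 := rowRoot_sq x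
    have hd : HasDerivAt rowRoot (-(Real.sin x * Real.cos x) / (3 * rowRoot x)) x := by
      have h1 : HasDerivAt (fun y => 1 - Real.sin y ^ 2 / 3)
          (-(2 * Real.sin x * Real.cos x / 3)) x := by
        have := (((Real.hasDerivAt_sin x).pow 2).div_const 3).const_sub 1
        simpa using this
      have h2 := h1.sqrt (by nlinarith [Real.sin_sq_le_one x])
      refine h2.congr_deriv ?_
      change _ / (2 * rowRoot x) = _
      field_simp
    have h1 := ((Real.hasDerivAt_cos x).const_add 1).log (by positivity)
    have h2 := (hd.add (Real.hasDerivAt_cos x)).log (add_pos_of_pos_of_nonneg hq hc).ne'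
    refine (h1.sub h2).congr_deriv ?_
    rw [smoothWeight]
    have hs := Real.sin_sq_add_cos_sq x
    simp only [Pi.add_apply]
    have e : 3 * rowRoot x ^ 2 = 2 + Real.cos x ^ 2 := by linarith
    field_simp
    linear_combination (-(Real.sin x * rowRoot x)) * e
  rw [intervalIntegral.integral_eq_sub_of_hasDerivAt hder
    (contDiff_smoothWeight.continuous.intervalIntegrable _ _), hroot0, hroot1]
  simp only [Real.cos_pi_div_two, Real.cos_zero, add_zero, Real.log_one, sub_self]
  rw [Real.log_sqrt (by norm_num), show (2 / 3 : ℝ) = (3 / 2)⁻¹ by norm_num, Real.log_inv]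
  ring

lemma integral_smoothWeight :
    ∫ x in (0 : ℝ)..Real.pi, smoothWeight x = Real.log (3 / 2) := by
  have hintegral : ∀ a b, IntervalIntegrable smoothWeight MeasureTheory.volume a b := fun a b =>
    contDiff_smoothWeight.continuous.intervalIntegrable _ _
  rw [← intervalIntegral.integral_add_adjacent_intervals (hintegral 0 (Real.pi / 2)) (hintegral _ _)]
  have h := intervalIntegral.integral_comp_sub_left (a := 0) (b := Real.pi / 2) smoothWeight
    Real.pi
  have h2 : ∀ x, smoothWeight (Real.pi - x) = smoothWeight x := by
    intro x; simp [smoothWeight, rowRoot, Real.sin_pi_sub]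
  simp only [h2, sub_zero] at h
  rw [show Real.pi - Real.pi / 2 = Real.pi / 2 by ring] at h
  rw [← h, integral_smoothWeight_half]
  ring

lemma exists_abs_sum_rowWeight_sub_le :
    ∃ C : ℝ, ∀ n : ℕ, 0 < n → |∑ j ∈ Ico 1 n, rowWeight (Real.pi * j / n) -
      (2 * n / Real.pi * (Real.log n + Real.eulerMascheroniConstant + Real.log (2 / Real.pi)) +
        n / Real.pi * Real.log (3 / 2))| ≤ C / n := by
  obtain ⟨C, hC⟩ := exists_abs_sum_inv_sin_sub_le
  obtain ⟨D, hD⟩ := exists_abs_sum_sub_integral_le Real.pi_pos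
    (contDiff_smoothWeight.contDiffOn (s := Set.Icc 0 Real.pi))
  refine ⟨C + D, fun n hn => ?_⟩
  have h1 := hC n hn
  have h2 := hD n hn
  rw [integral_smoothWeight, show smoothWeight 0 = 0 by simp [smoothWeight],
    show smoothWeight Real.pi = 0 by simp [smoothWeight], add_zero, zero_div, sub_zero] at h2
  rw [sum_congr rfl fun j hj => rowWeight_eq (sin_pi_mul_div_pos (mem_Ico.1 hj).1
    (mem_Ico.1 hj).2), sum_add_distrib, add_div, add_sub_add_comm]
  exact (abs_add_le _ _).trans (add_le_add h1 h2)

/-! ### Bounds for the row data near the origin -/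

lemma rowRoot_le_one (θ : ℝ) : rowRoot θ ≤ 1 := by
  nlinarith [rowRoot_sq θ, rowRoot_pos θ, sq_nonneg (Real.sin θ)]

lemma four_fifths_le_rowRoot (θ : ℝ) : 4 / 5 ≤ rowRoot θ := by
  nlinarith [rowRoot_sq θ, rowRoot_pos θ, Real.sin_sq_le_one θ]

lemma one_sub_rowRoot_le (θ : ℝ) : 1 - rowRoot θ ≤ Real.sin θ ^ 2 / 3 := by
  nlinarith [rowRoot_sq θ, rowRoot_pos θ, rowRoot_le_one θ]

lemma sin_lower_bound {θ : ℝ} (h0 : 0 < θ) (h1 : θ ≤ Real.pi / 2) :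
    2 / Real.pi * θ ≤ Real.sin θ := Real.mul_le_sin h0.le h1

/-- A crude rate valid up to `π/2`: at `θ = πj/n` the `n`-th power is at most `e^{-2j}`, summable
uniformly in `n`. If `s ≤ q` then `r ≤ 1 - s`; otherwise `|r| ≤ 1/4 ≤ e^{-1}`. -/
lemma abs_rowRatio_le {θ : ℝ} (h0 : 0 < θ) (h1 : θ ≤ Real.pi / 2) :
    |rowRatio θ| ≤ Real.exp (-(2 / Real.pi * θ)) := by
  have hpi := Real.pi_pos
  have hs : 0 < Real.sin θ := Real.sin_pos_of_pos_of_lt_pi h0 (by linarith)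
  have hs1 := Real.sin_le_one θ
  have hq := rowRoot_pos θ
  have hq1 := rowRoot_le_one θ
  have hq2 := four_fifths_le_rowRoot θ
  have hsl := sin_lower_bound h0 h1
  rcases le_total (Real.sin θ) (rowRoot θ) with h | h
  · have h2 : rowRatio θ ≤ 1 - Real.sin θ := by
      rw [rowRatio, div_le_iff₀ (by linarith)]
      nlinarith
    have h3 : 0 ≤ rowRatio θ := div_nonneg (by linarith) (by linarith)
    rw [abs_of_nonneg h3]
    have := Real.add_one_le_exp (-(2 / Real.pi * θ))
    linarith
  · have h2 : |rowRatio θ| ≤ 1 / 4 := by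
      rw [rowRatio, abs_div, abs_of_pos (a := rowRoot θ + _) (by linarith),
        div_le_iff₀ (by linarith), abs_le]
      constructor <;> linarith
    have h3 : Real.exp (-1) ≤ Real.exp (-(2 / Real.pi * θ)) := by
      rw [Real.exp_le_exp, neg_le_neg_iff, div_mul_eq_mul_div, div_le_one hpi]
      linarith
    have h4 : (1 / 4 : ℝ) ≤ Real.exp (-1) := by
      rw [Real.exp_neg, one_div]
      exact inv_anti₀ (Real.exp_pos 1) (by linarith [Real.exp_one_lt_d9])
    linarith

/-- With `u = s/q = θ + O(θ³)`, the ratio is `(1 - u)/(1 + u)`, which agrees with `e^{-2u}` through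
second order. The cubic errors `5/6`, `3`, `4` and `2` total less than `20`; for `θ ≥ 1/2` the bound
`2 ≤ 20 θ³` is enough. -/
lemma abs_rowRatio_sub_exp_le {θ : ℝ} (h0 : 0 < θ) (h1 : θ ≤ Real.pi / 2) :
    |rowRatio θ - Real.exp (-(2 * θ))| ≤ 20 * θ ^ 3 := by
  have hpi := Real.pi_pos
  have hs : 0 < Real.sin θ := Real.sin_pos_of_pos_of_lt_pi h0 (by linarith)
  rcases le_total θ (1 / 2) with h | h
  · have hq := rowRoot_pos θ
    have hq1 := rowRoot_le_one θ
    have hq2 := four_fifths_le_rowRoot θ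
    have hq3 := one_sub_rowRoot_le θ
    set s := Real.sin θ
    set q := rowRoot θ
    set u := s / q with hu
    have huq : u * q = s := by rw [hu]; field_simp
    have hsθ : s ≤ θ := Real.sin_le h0.le
    have hs3 : θ - θ ^ 3 / 4 ≤ s := by
      linarith [Real.sin_gt_sub_cube h0, show 0 < θ ^ 3 by positivity]
    have hus : s ≤ u := by rw [hu, le_div_iff₀ hq]; nlinarith
    have hu0 : 0 < u := by positivity
    have hu2 : u ≤ 5 / 4 * s := by nlinarith
    have hss : s ^ 2 ≤ θ ^ 2 := by nlinarith
    have hss3 : s ^ 3 ≤ θ ^ 3 := by gcongr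
    have hu3 : u - s ≤ 5 / 12 * θ ^ 3 := by
      have e1 : u - s = u * (1 - q) := by rw [mul_sub, huq]; ring
      rw [e1]
      calc u * (1 - q) ≤ 5 / 4 * s * (s ^ 2 / 3) :=
            mul_le_mul hu2 hq3 (by linarith) (by positivity)
        _ = 5 / 12 * s ^ 3 := by ring
        _ ≤ 5 / 12 * θ ^ 3 := by gcongr
    have hθ3 : 0 < θ ^ 3 := by positivity
    have hd : |u - θ| ≤ 5 / 12 * θ ^ 3 := by rw [abs_le]; constructor <;> linarith
    have hr : rowRatio θ = 1 - 2 * u + 2 * u ^ 2 - 2 * u ^ 3 / (1 + u) := by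
      have : rowRatio θ = (q - s) / (q + s) := rfl
      rw [this, ← huq]
      field_simp
      ring
    have hcube : |2 * u ^ 3 / (1 + u)| ≤ 4 * θ ^ 3 := by
      rw [abs_of_pos (by positivity), div_le_iff₀ (by linarith)]
      have h5 : u ^ 3 ≤ (5 / 4 * θ) ^ 3 := by gcongr; linarith
      have h6 : (5 / 4 * θ) ^ 3 ≤ 2 * θ ^ 3 := by nlinarith
      nlinarith [mul_pos hθ3 hu0]
    have hexp : |Real.exp (-(2 * θ)) - (1 - 2 * θ + 2 * θ ^ 2)| ≤ 2 * θ ^ 3 := by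
      have := Real.exp_bound (x := -(2 * θ)) (by rw [abs_neg, abs_of_pos (by positivity)]; linarith)
        (n := 3) (by norm_num)
      rw [abs_neg, abs_of_pos (by positivity : 0 < 2 * θ)] at this
      simp only [sum_range_succ, sum_range_zero] at this
      norm_num [Nat.factorial] at this
      rw [show 1 + -(2 * θ) + (2 * θ) ^ 2 / 2 = 1 - 2 * θ + 2 * θ ^ 2 by ring] at this
      nlinarith
    have hquad : |2 * u ^ 2 - 2 * θ ^ 2| ≤ 3 * θ ^ 3 := by
      rw [show 2 * u ^ 2 - 2 * θ ^ 2 = (u - θ) * (2 * (u + θ)) by ring, abs_mul,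
        abs_of_pos (by positivity : 0 < 2 * (u + θ))]
      have : 2 * (u + θ) ≤ 3 := by linarith
      nlinarith [abs_nonneg (u - θ)]
    rw [hr, abs_le]
    rw [abs_le] at hcube hexp hquad hd
    constructor <;> linarith
  · have h2 := (abs_rowRatio_lt_one hs).le
    have h3 : |Real.exp (-(2 * θ))| ≤ 1 := by
      rw [abs_of_pos (Real.exp_pos _)]
      exact Real.exp_le_one_iff.2 (by linarith)
    have h4 : (1 / 2 : ℝ) ^ 3 ≤ θ ^ 3 := by gcongr
    refine (abs_sub _ _).trans ?_
    linarith

lemma half_sq_le_sin_mul_rowRoot_mul {θ : ℝ} (h0 : 0 < θ) (h1 : θ ≤ Real.pi / 2) :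
    θ ^ 2 / 2 ≤ Real.sin θ * rowRoot θ * θ := by
  have hpi := Real.pi_pos
  have h2 := sin_lower_bound h0 h1
  have h3 := four_fifths_le_rowRoot θ
  have h4 : 5 / 8 ≤ 2 / Real.pi := by
    rw [le_div_iff₀ hpi]
    linarith [Real.pi_lt_d2]
  have h5 : 5 / 8 * θ ≤ Real.sin θ := by nlinarith
  have h6 : 5 / 8 * θ * (4 / 5) ≤ Real.sin θ * rowRoot θ :=
    mul_le_mul h5 h3 (by norm_num) (by nlinarith)
  nlinarith

/-- The difference is `(θ - s q)/(s q θ)`, with numerator at most `(4/3) θ³` and denominator at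
least `θ²/2`. -/
lemma abs_rowWeight_sub_inv_le {θ : ℝ} (h0 : 0 < θ) (h1 : θ ≤ Real.pi / 2) :
    |rowWeight θ - 1 / θ| ≤ 3 * θ := by
  have hpi := Real.pi_pos
  have hs : 0 < Real.sin θ := Real.sin_pos_of_pos_of_lt_pi h0 (by linarith)
  have hsθ : Real.sin θ ≤ θ := Real.sin_le h0.le
  have hq := rowRoot_pos θ
  have hq1 := rowRoot_le_one θ
  have hq3 := one_sub_rowRoot_le θ
  have hlow := half_sq_le_sin_mul_rowRoot_mul h0 h1
  have hcube := Real.sin_gt_sub_cube h0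
  set s := Real.sin θ with hsdef
  set q := rowRoot θ with hqdef
  have e : rowWeight θ - 1 / θ = (θ - s * q) / (s * q * θ) := by
    rw [rowWeight, ← hsdef, ← hqdef]
    field_simp
  have h5 : 0 ≤ θ - s * q := by nlinarith
  have h6 : θ - s * q ≤ 4 / 3 * θ ^ 3 := by
    have : s * (1 - q) ≤ θ * (θ ^ 2 / 3) :=
      mul_le_mul hsθ (hq3.trans (by gcongr)) (by linarith) h0.le
    nlinarith
  rw [e, abs_of_nonneg (by positivity), div_le_iff₀ (by positivity)]
  nlinarith

/-! ### The exponentially decaying part -/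

/-- The correction factor `2 x / (1 - x)`, where `x` is the `n`-th power of the row ratio. -/
noncomputable def corr (x : ℝ) : ℝ := 2 * x / (1 - x)

lemma abs_corr_le {x : ℝ} (hx : |x| ≤ 1 / 2) : |corr x| ≤ 4 * |x| := by
  have h := abs_le.1 hx
  rw [corr, abs_div, abs_of_pos (a := 1 - x) (by linarith), abs_mul, abs_of_pos (a := (2 : ℝ))
    (by norm_num), div_le_iff₀ (by linarith)]
  nlinarith [abs_nonneg x]

/-- The factor is the maximum of `2/(1 - x)²` on `|x| ≤ 1/2`. -/
lemma abs_corr_sub_le {x y : ℝ} (hx : |x| ≤ 1 / 2) (hy : |y| ≤ 1 / 2) :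
    |corr x - corr y| ≤ 8 * |x - y| := by
  have h := abs_le.1 hx
  have h' := abs_le.1 hy
  have hx1 : 0 < 1 - x := by linarith
  have hy1 : 0 < 1 - y := by linarith
  have e : corr x - corr y = 2 * (x - y) / ((1 - x) * (1 - y)) := by
    rw [corr, corr]; field_simp; ring
  rw [e, abs_div, abs_of_pos (mul_pos hx1 hy1), abs_mul, abs_of_pos (a := (2 : ℝ)) (by norm_num),
    div_le_iff₀ (mul_pos hx1 hy1)]
  have : 1 / 2 * (1 / 2) ≤ (1 - x) * (1 - y) :=
    mul_le_mul (by linarith) (by linarith) (by norm_num) hx1.le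
  nlinarith [abs_nonneg (x - y)]

lemma exp_neg_two_mul_le_half {j : ℕ} (hj : 0 < j) : Real.exp (-(2 * j)) ≤ 1 / 2 := by
  have hj' : (1 : ℝ) ≤ j := by exact_mod_cast hj
  rw [Real.exp_neg, one_div]
  exact inv_anti₀ (by norm_num) (by linarith [Real.add_one_le_exp (2 * (j : ℝ))])

/-- The limit shape of the `j`-th correction term. -/
noncomputable def limitTerm (n j : ℕ) : ℝ :=
  n / (Real.pi * j) * corr (Real.exp (-(2 * Real.pi * j)))

lemma exp_neg_two_pi_mul_le (j : ℕ) :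
    Real.exp (-(2 * Real.pi * j)) ≤ Real.exp (-(2 * j)) := by
  rw [Real.exp_le_exp, neg_le_neg_iff]
  have : (0 : ℝ) ≤ j := by positivity
  nlinarith [Real.pi_gt_three]

/-- Split the error into that of the weight, `O(θ)`, and that of `rⁿ`, which is at most `n |r - ρ|
b^{n-1}` with `|r - ρ| = O(θ³)`. As `nθ = πj`, both are `O(j² e^{-2j}/n)`. -/
lemma abs_rowTerm_sub_limitTerm_le {n j : ℕ} (hj : 0 < j) (hjn : 2 * j ≤ n) :
    |rowWeight (Real.pi * j / n) * corr (rowRatio (Real.pi * j / n) ^ n) - limitTerm n j| ≤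
      8000 * ((j : ℝ) ^ 2 * Real.exp (-(2 * j))) / n := by
  have hpi := Real.pi_pos
  have hpi4 := Real.pi_lt_d2
  have hn : 0 < n := by omega
  have hn' : (0 : ℝ) < n := by exact_mod_cast hn
  have hj' : (1 : ℝ) ≤ j := by exact_mod_cast hj
  have hjn' : 2 * (j : ℝ) ≤ n := by exact_mod_cast hjn
  set θ := Real.pi * j / n with hθ
  have h0 : 0 < θ := by positivity
  have h1 : θ ≤ Real.pi / 2 := by
    rw [hθ, div_le_div_iff₀ hn' (by norm_num)]
    nlinarith
  have hnθ : n * θ = Real.pi * j := by rw [hθ]; field_simp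
  set E := Real.exp (-(2 * (j : ℝ))) with hE
  have hE0 : 0 < E := Real.exp_pos _
  have hE2 : E ≤ 1 / 2 := exp_neg_two_mul_le_half hj
  set b := Real.exp (-(2 / Real.pi * θ)) with hb
  have hbn : b ^ n = E := by
    rw [hb, hE, ← Real.exp_nat_mul]
    congr 1
    rw [show (n : ℝ) * -(2 / Real.pi * θ) = -(2 / Real.pi * (n * θ)) by ring, hnθ]
    field_simp
  -- Passing from exponent `n` to `n - 1` costs `1/b ≤ 3`.
  have hbn1 : b ^ (n - 1) ≤ 3 * E := by
    have e : b ^ (n - 1) * b = E := by rw [← pow_succ, Nat.sub_add_cancel hn, hbn]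
    have hb3 : 1 / 3 ≤ b := by
      have h3 : Real.exp (-1) ≤ b := by
        rw [hb, Real.exp_le_exp, neg_le_neg_iff, div_mul_eq_mul_div, div_le_one hpi]
        linarith
      refine le_trans ?_ h3
      rw [Real.exp_neg, one_div]
      exact inv_anti₀ (Real.exp_pos 1) (by linarith [Real.exp_one_lt_d9])
    have : 0 < b ^ (n - 1) := by positivity
    nlinarith
  set r := rowRatio θ with hr
  set ρ := Real.exp (-(2 * θ)) with hρ
  have hρn : ρ ^ n = Real.exp (-(2 * Real.pi * j)) := by
    rw [hρ, ← Real.exp_nat_mul]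
    congr 1
    linear_combination (-2) * hnθ
  have hrb : |r| ≤ b := abs_rowRatio_le h0 h1
  have hρb : |ρ| ≤ b := by
    rw [abs_of_pos (Real.exp_pos _), hb, Real.exp_le_exp, neg_le_neg_iff]
    have : 2 / Real.pi ≤ 2 := div_le_self (by norm_num) (by linarith [Real.pi_gt_three])
    exact mul_le_mul_of_nonneg_right this h0.le
  have hrn : |r ^ n| ≤ E := by
    rw [abs_pow, ← hbn]
    exact pow_le_pow_left₀ (abs_nonneg _) hrb n
  have hρn' : |ρ ^ n| ≤ E := by
    rw [abs_pow, ← hbn]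
    exact pow_le_pow_left₀ (abs_nonneg _) hρb n
  have hdiff : |r ^ n - ρ ^ n| ≤ 60 * (n * θ) * θ ^ 2 * E := by
    have h2 : |r - ρ| ≤ 20 * θ ^ 3 := abs_rowRatio_sub_exp_le h0 h1
    calc |r ^ n - ρ ^ n| ≤ |r - ρ| * n * max |r| |ρ| ^ (n - 1) := abs_pow_sub_pow_le _ _ _
      _ ≤ 20 * θ ^ 3 * n * (3 * E) := by
          have : max |r| |ρ| ^ (n - 1) ≤ b ^ (n - 1) :=
            pow_le_pow_left₀ ((abs_nonneg _).trans (le_max_left _ _)) (max_le hrb hρb) _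
          gcongr
          exact this.trans hbn1
      _ = _ := by ring
  have hcorr1 : |corr (r ^ n)| ≤ 4 * E := by
    have := abs_corr_le (hrn.trans hE2)
    linarith
  have hcorr2 : |corr (r ^ n) - corr (ρ ^ n)| ≤ 8 * (60 * (n * θ) * θ ^ 2 * E) := by
    have := abs_corr_sub_le (hrn.trans hE2) (hρn'.trans hE2)
    linarith
  have hlim : limitTerm n j = 1 / θ * corr (ρ ^ n) := by
    rw [limitTerm, hρn, hθ, one_div_div]
  have hw := abs_rowWeight_sub_inv_le h0 h1
  rw [hlim, show rowWeight θ * corr (r ^ n) - 1 / θ * corr (ρ ^ n) =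
    (rowWeight θ - 1 / θ) * corr (r ^ n) + 1 / θ * (corr (r ^ n) - corr (ρ ^ n)) by ring]
  have hfin : 12 * (n * θ) + 480 * (n * θ) ^ 2 ≤ 8000 * (j : ℝ) ^ 2 := by
    rw [hnθ]
    have h3 : Real.pi * j ≤ 4 * j ^ 2 := by nlinarith
    have h4 : Real.pi ^ 2 ≤ 10 := by nlinarith
    have h5 : (Real.pi * j) ^ 2 ≤ 10 * (j : ℝ) ^ 2 := by
      rw [mul_pow]; exact mul_le_mul_of_nonneg_right h4 (by positivity)
    nlinarith
  calc |(rowWeight θ - 1 / θ) * corr (r ^ n) + 1 / θ * (corr (r ^ n) - corr (ρ ^ n))|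
      ≤ |rowWeight θ - 1 / θ| * |corr (r ^ n)| + 1 / θ * |corr (r ^ n) - corr (ρ ^ n)| := by
        refine (abs_add_le _ _).trans (le_of_eq ?_)
        rw [abs_mul, abs_mul, abs_of_pos (by positivity : 0 < 1 / θ)]
    _ ≤ 3 * θ * (4 * E) + 1 / θ * (8 * (60 * (n * θ) * θ ^ 2 * E)) := by gcongr
    _ = (12 * (n * θ) + 480 * (n * θ) ^ 2) * E / n := by field_simp; ring
    _ ≤ 8000 * (j : ℝ) ^ 2 * E / n := by gcongr
    _ = _ := by ring

/-- The tail of the limit series, beyond the rows of the half sum, obeys the same majorant: `n ≤ 2j`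
absorbs the powers of `n`. -/
lemma abs_limitTerm_le {n j : ℕ} (hj : 0 < j) (hn : 0 < n) (hjn : n ≤ 2 * j) :
    |limitTerm n j| ≤ 8000 * ((j : ℝ) ^ 2 * Real.exp (-(2 * j))) / n := by
  have hpi := Real.pi_gt_three
  have hn' : (0 : ℝ) < n := by exact_mod_cast hn
  have hj' : (1 : ℝ) ≤ j := by exact_mod_cast hj
  have hjn' : (n : ℝ) ≤ 2 * j := by exact_mod_cast hjn
  set E := Real.exp (-(2 * (j : ℝ))) with hE
  have hE0 : 0 < E := Real.exp_pos _
  have h1 : |Real.exp (-(2 * Real.pi * j))| ≤ E := by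
    rw [abs_of_pos (Real.exp_pos _)]
    exact exp_neg_two_pi_mul_le j
  have h2 := abs_corr_le (h1.trans (exp_neg_two_mul_le_half hj))
  rw [limitTerm, abs_mul, abs_of_pos (by positivity), le_div_iff₀ hn']
  have h3 : n / (Real.pi * j) ≤ (1 : ℝ) := by
    rw [div_le_one (by positivity)]; nlinarith
  calc n / (Real.pi * j) * |corr (Real.exp (-(2 * Real.pi * j)))| * n
      ≤ 1 * (4 * E) * (2 * j) := by gcongr; linarith
    _ ≤ 8000 * ((j : ℝ) ^ 2 * E) := by
        have : 0 ≤ E * j * (j - 1) := mul_nonneg (by positivity) (by linarith)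
        nlinarith [mul_pos hE0 (by linarith : (0 : ℝ) < j)]

lemma summable_sq_mul_exp :
    Summable fun i : ℕ => ((i + 1 : ℕ) : ℝ) ^ 2 * Real.exp (-(2 * ((i + 1 : ℕ) : ℝ))) := by
  have h := Real.summable_pow_mul_exp_neg_nat_mul 2 (r := 2) (by norm_num)
  have h2 := (summable_nat_add_iff 1).2 h
  simpa [neg_mul] using h2

/-- The series `∑ 1 / (j (e^{2πj} - 1))` over `j ≥ 1`. -/
noncomputable def expSeries : ℝ :=
  ∑' i : ℕ, 1 / (((i + 1 : ℕ) : ℝ) * (Real.exp (2 * Real.pi * ((i + 1 : ℕ) : ℝ)) - 1))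

lemma limitTerm_succ (n i : ℕ) : limitTerm n (i + 1) = 2 * n / Real.pi *
    (1 / (((i + 1 : ℕ) : ℝ) * (Real.exp (2 * Real.pi * ((i + 1 : ℕ) : ℝ)) - 1))) := by
  have hpi := Real.pi_pos
  have hi : (0 : ℝ) < (i + 1 : ℕ) := by positivity
  have h1 : (1 : ℝ) < Real.exp (2 * Real.pi * ((i + 1 : ℕ) : ℝ)) :=
    Real.one_lt_exp_iff.2 (by positivity)
  rw [limitTerm, corr, Real.exp_neg]
  have h2 : Real.exp (2 * Real.pi * ((i + 1 : ℕ) : ℝ)) - 1 ≠ 0 := by linarith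
  set X := Real.exp (2 * Real.pi * ((i + 1 : ℕ) : ℝ))
  have hX : 0 < X := by linarith
  have h3 : 1 - X⁻¹ = (X - 1) / X := by field_simp
  rw [h3]
  field_simp

lemma summable_limitTerm {n : ℕ} (hn : 0 < n) : Summable fun i => limitTerm n (i + 1) := by
  have hs := (summable_sq_mul_exp.mul_left 8000).div_const (n : ℝ)
  refine (summable_nat_add_iff n).1 ?_
  refine Summable.of_norm_bounded ((summable_nat_add_iff n).2 hs) fun i => ?_
  rw [Real.norm_eq_abs]
  exact abs_limitTerm_le (by omega) hn (by omega)

lemma tsum_limitTerm (n : ℕ) :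
    ∑' i : ℕ, limitTerm n (i + 1) = 2 * n / Real.pi * expSeries := by
  simp_rw [limitTerm_succ]
  rw [tsum_mul_left, expSeries]

lemma exists_abs_sum_half_sub_le :
    ∃ C : ℝ, ∀ n m : ℕ, 0 < n → 2 * m ≤ n → n ≤ 2 * (m + 1) →
      |∑ j ∈ Ico 1 (m + 1), rowWeight (Real.pi * j / n) *
        corr (rowRatio (Real.pi * j / n) ^ n) - 2 * n / Real.pi * expSeries| ≤ C / n := by
  refine ⟨8000 * ∑' i : ℕ, ((i + 1 : ℕ) : ℝ) ^ 2 * Real.exp (-(2 * ((i + 1 : ℕ) : ℝ))),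
    fun n m hn h1 h2 => ?_⟩
  set T : ℕ → ℝ := fun j => rowWeight (Real.pi * j / n) * corr (rowRatio (Real.pi * j / n) ^ n)
  -- Padding by zeros allows a termwise comparison with the limit series.
  set T' : ℕ → ℝ := fun i => if i < m then T (i + 1) else 0
  have hpos : ∀ i, i < m → T' i = T (i + 1) := fun i hi => if_pos hi
  have hneg : ∀ i, ¬ i < m → T' i = 0 := fun i hi => if_neg hi
  have hT : HasSum T' (∑ j ∈ Ico 1 (m + 1), T j) := by
    have e : ∑ j ∈ Ico 1 (m + 1), T j = ∑ i ∈ range m, T' i := by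
      rw [sum_Ico_eq_sum_range]
      refine sum_congr rfl fun i hi => ?_
      rw [hpos i (mem_range.1 hi), add_comm]
    rw [e]
    exact hasSum_sum_of_ne_finset_zero fun i hi => hneg i (by simpa using hi)
  have hsub := hT.sub (summable_limitTerm hn).hasSum
  rw [tsum_limitTerm] at hsub
  rw [← hsub.tsum_eq, ← Real.norm_eq_abs]
  refine tsum_of_norm_bounded ((summable_sq_mul_exp.hasSum.mul_left 8000).div_const _) fun i => ?_
  rw [Real.norm_eq_abs]
  by_cases hi : i < m
  · rw [hpos i hi]
    exact abs_rowTerm_sub_limitTerm_le (by omega) (by omega)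
  · rw [hneg i hi, zero_sub, abs_neg]
    exact abs_limitTerm_le (by omega) hn (by omega)

/-- The two upper limits differ for even `n`, so the middle term is counted once. -/
lemma sum_Ico_one_eq_add_of_symm {f : ℕ → ℝ} {n : ℕ} (hn : 0 < n)
    (hf : ∀ j ∈ Ico 1 n, f (n - j) = f j) :
    ∑ j ∈ Ico 1 n, f j =
      ∑ j ∈ Ico 1 (n / 2 + 1), f j + ∑ j ∈ Ico 1 ((n - 1) / 2 + 1), f j := by
  rcases Nat.lt_or_ge n 2 with h | h
  · obtain rfl : n = 1 := by omega
    simp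
  rw [← sum_Ico_consecutive f (by omega : 1 ≤ n / 2 + 1) (by omega : n / 2 + 1 ≤ n)]
  congr 1
  have := sum_Ico_reflect f (n / 2 + 1) (m := n) (n := n) (by omega)
  rw [show n + 1 - n = 1 by omega, show n + 1 - (n / 2 + 1) = (n - 1) / 2 + 1 by omega] at this
  rw [← this]
  refine sum_congr rfl fun j hj => (hf j ?_).symm
  rw [mem_Ico] at hj ⊢
  omega

lemma exists_abs_sum_corr_sub_le :
    ∃ C : ℝ, ∀ n : ℕ, 0 < n → |∑ j ∈ Ico 1 n, rowWeight (Real.pi * j / n) *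
        corr (rowRatio (Real.pi * j / n) ^ n) - 4 * n / Real.pi * expSeries| ≤ C / n := by
  obtain ⟨C, hC⟩ := exists_abs_sum_half_sub_le
  refine ⟨2 * C, fun n hn => ?_⟩
  rw [sum_Ico_one_eq_add_of_symm (f := fun j => rowWeight (Real.pi * (j : ℝ) / n) *
        corr (rowRatio (Real.pi * j / n) ^ n)) hn]
  · have h1 := hC n (n / 2) hn (by omega) (by omega)
    have h2 := hC n ((n - 1) / 2) hn (by omega) (by omega)
    rw [abs_le] at *
    have e : 4 * n / Real.pi * expSeries = 2 * (2 * n / Real.pi * expSeries) := by ring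
    have e' : 2 * C / n = 2 * (C / n) := by ring
    rw [e, e']
    constructor <;> linarith
  · intro j hj
    rw [mem_Ico] at hj
    have hn : (n : ℝ) ≠ 0 := by exact_mod_cast (by omega : n ≠ 0)
    have e : Real.pi * (n - j : ℕ) / n = Real.pi - Real.pi * j / n := by
      rw [Nat.cast_sub hj.2.le]
      field_simp
    simp only [e, rowWeight, rowRatio, rowRoot, Real.sin_pi_sub]

/-! ### The arithmetic-geometric mean integral -/

/-- The integrand of the complete elliptic integral in the symmetric form of Gauss. -/
noncomputable def agmIntegrand (a b x : ℝ) : ℝ := 1 / √((x ^ 2 + a ^ 2) * (x ^ 2 + b ^ 2))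

/-- The complete elliptic integral in the symmetric form of Gauss. -/
noncomputable def agmIntegral (a b : ℝ) : ℝ := ∫ x, agmIntegrand a b x

lemma agmIntegrand_abs (a b x : ℝ) : agmIntegrand a b |x| = agmIntegrand a b x := by
  simp [agmIntegrand]

lemma agmIntegral_eq_two_mul (a b : ℝ) :
    agmIntegral a b = 2 * ∫ x in Set.Ioi (0 : ℝ), agmIntegrand a b x := by
  rw [← integral_comp_abs]
  simp_rw [agmIntegrand_abs]
  rfl

/-- Substitute `t = (x - ab/x)/2`, an increasing bijection from `(0, ∞)` to `ℝ` with inverse `t ↦ t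
+ √(t² + ab)`. The half line on one side yields the factor `2` that evenness supplies on the other.
-/
lemma agmIntegral_step {a b : ℝ} (ha : 0 < a) (hb : 0 < b) :
    agmIntegral ((a + b) / 2) √(a * b) = agmIntegral a b := by
  set f : ℝ → ℝ := fun x => (x - a * b / x) / 2 with hf
  have hab : 0 < a * b := mul_pos ha hb
  have hder : ∀ x ∈ Set.Ioi (0 : ℝ),
      HasDerivWithinAt f ((1 + a * b / x ^ 2) / 2) (Set.Ioi 0) x := by
    intro x hx
    have hx0 : x ≠ 0 := (ne_of_gt hx)
    have h1 : HasDerivAt f ((1 - a * b * (-(x ^ 2)⁻¹)) / 2) x := by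
      have := ((hasDerivAt_id x).sub ((hasDerivAt_inv hx0).const_mul (a * b))).div_const 2
      exact this
    exact (h1.congr_deriv (by ring)).hasDerivWithinAt
  have hinj : Set.InjOn f (Set.Ioi 0) := by
    intro x hx y hy h
    have hx0 : 0 < x := hx
    have hy0 : 0 < y := hy
    simp only [hf] at h
    have h1 : (x - y) * (1 + a * b / (x * y)) = 0 := by
      field_simp at h ⊢
      linear_combination h
    rcases mul_eq_zero.1 h1 with h2 | h2
    · linarith
    · have : 0 < 1 + a * b / (x * y) := by positivity
      linarith
  have himg : f '' Set.Ioi 0 = Set.univ := by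
    refine Set.eq_univ_of_forall fun t => ?_
    have hs : 0 ≤ t ^ 2 + a * b := by positivity
    have hsq := Real.sq_sqrt hs
    have hlt : |t| < √(t ^ 2 + a * b) := by
      rw [← Real.sqrt_sq_eq_abs]
      exact Real.sqrt_lt_sqrt (sq_nonneg t) (by linarith)
    have hpos : 0 < t + √(t ^ 2 + a * b) := by linarith [neg_abs_le t]
    refine ⟨t + √(t ^ 2 + a * b), hpos, ?_⟩
    simp only [hf]
    field_simp
    linear_combination hsq
  have h := integral_image_eq_integral_abs_deriv_smul measurableSet_Ioi hder hinj
    (agmIntegrand ((a + b) / 2) √(a * b))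
  rw [himg, setIntegral_univ] at h
  rw [agmIntegral, h, agmIntegral_eq_two_mul, ← integral_const_mul]
  refine setIntegral_congr_fun measurableSet_Ioi fun x hx => ?_
  have hx0 : 0 < x := hx
  simp only [agmIntegrand, smul_eq_mul, hf]
  rw [Real.sq_sqrt hab.le, abs_of_pos (by positivity)]
  -- The first factor is `(x² + a²)(x² + b²)/(4x²)` and the second is `((x² + ab)/(2x))²`.
  have e : (((x - a * b / x) / 2) ^ 2 + ((a + b) / 2) ^ 2) * (((x - a * b / x) / 2) ^ 2 + a * b) =
      (x ^ 2 + a ^ 2) * (x ^ 2 + b ^ 2) * ((x ^ 2 + a * b) / (4 * x ^ 2)) ^ 2 := by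
    field_simp
    ring
  rw [e, Real.sqrt_mul (by positivity), Real.sqrt_sq (by positivity)]
  have : 0 < √((x ^ 2 + a ^ 2) * (x ^ 2 + b ^ 2)) := by positivity
  field_simp
  ring

lemma agmIntegrand_self {a : ℝ} (x : ℝ) : agmIntegrand a a x = 1 / (x ^ 2 + a ^ 2) := by
  rw [agmIntegrand, ← sq, Real.sqrt_sq (by positivity)]

lemma agmIntegrand_self_eq {a : ℝ} (ha : 0 < a) (x : ℝ) :
    agmIntegrand a a x = (a ^ 2)⁻¹ * (1 + (a⁻¹ * x) ^ 2)⁻¹ := by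
  rw [agmIntegrand_self]
  field_simp
  ring

lemma integrable_agmIntegrand_self {a : ℝ} (ha : 0 < a) : Integrable (agmIntegrand a a) := by
  have h : agmIntegrand a a = fun x => (a ^ 2)⁻¹ * (1 + (a⁻¹ * x) ^ 2)⁻¹ :=
    funext (agmIntegrand_self_eq ha)
  rw [h]
  exact (integrable_inv_one_add_sq.comp_mul_left' (inv_pos.2 ha).ne').const_mul _

lemma agmIntegral_self {a : ℝ} (ha : 0 < a) : agmIntegral a a = Real.pi / a := by
  rw [agmIntegral]
  simp_rw [agmIntegrand_self_eq ha]
  rw [integral_const_mul, Measure.integral_comp_mul_left (fun x : ℝ => (1 + x ^ 2)⁻¹) a⁻¹,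
    integral_univ_inv_one_add_sq, inv_inv, abs_of_pos ha, smul_eq_mul]
  field_simp

lemma agmIntegrand_le {a b a' b' : ℝ} (ha : 0 < a) (hb : 0 < b) (haa : a ≤ a') (hbb : b ≤ b')
    (x : ℝ) : agmIntegrand a' b' x ≤ agmIntegrand a b x := by
  unfold agmIntegrand
  gcongr

lemma integrable_agmIntegrand {a b : ℝ} (hb : 0 < b) (hba : b ≤ a) :
    Integrable (agmIntegrand a b) := by
  have ha : 0 < a := hb.trans_le hba
  refine (integrable_agmIntegrand_self hb).mono' ?_ (Eventually.of_forall fun x => ?_)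
  · refine Continuous.aestronglyMeasurable ?_
    unfold agmIntegrand
    refine continuous_const.div (by fun_prop) fun x => ?_
    positivity
  · rw [Real.norm_eq_abs, abs_of_nonneg (by unfold agmIntegrand; positivity)]
    exact agmIntegrand_le hb hb hba le_rfl x

/-- Compare with equal parameters. This pins down the invariant once both parameters of the
iteration tend to the same limit. -/
lemma agmIntegral_mem_Icc {a b : ℝ} (hb : 0 < b) (hba : b ≤ a) :
    agmIntegral a b ∈ Set.Icc (Real.pi / a) (Real.pi / b) := by
  have ha : 0 < a := hb.trans_le hba
  rw [← agmIntegral_self ha, ← agmIntegral_self hb]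
  exact ⟨integral_mono (integrable_agmIntegrand_self ha) (integrable_agmIntegrand hb hba)
      (agmIntegrand_le ha hb le_rfl hba),
    integral_mono (integrable_agmIntegrand hb hba) (integrable_agmIntegrand_self hb)
      (agmIntegrand_le hb hb hba le_rfl)⟩

lemma agmIntegral_smul {a b c : ℝ} (hc : 0 < c) :
    agmIntegral (c * a) (c * b) = agmIntegral a b / c := by
  have h : ∀ x, agmIntegrand (c * a) (c * b) x = (c ^ 2)⁻¹ * agmIntegrand a b (c⁻¹ * x) := by
    intro x
    unfold agmIntegrand
    have e : (x ^ 2 + (c * a) ^ 2) * (x ^ 2 + (c * b) ^ 2) =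
        (c ^ 2) ^ 2 * (((c⁻¹ * x) ^ 2 + a ^ 2) * ((c⁻¹ * x) ^ 2 + b ^ 2)) := by
      field_simp
    rw [e, Real.sqrt_mul (by positivity), Real.sqrt_sq (by positivity), one_div, mul_inv, one_div]
  rw [agmIntegral]
  simp_rw [h]
  rw [integral_const_mul, Measure.integral_comp_mul_left (agmIntegrand a b) c⁻¹, inv_inv,
    abs_of_pos hc, smul_eq_mul, ← agmIntegral]
  field_simp

/-- The lemniscatic case, evaluated through the beta function. -/
lemma agmIntegral_sqrt_two_one :
    agmIntegral √2 1 = Real.Gamma (1 / 4) ^ 2 * √Real.pi / (2 * Real.pi * √2) := by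
  -- The substitution `t = (1 + x²)⁻²` turns the integral for `B(1/4, 1/2)` into that of `4/√((x² +
  -- 2)(x² + 1))`.
  set f : ℝ → ℝ := fun x => ((1 + x ^ 2) ^ 2)⁻¹ with hf
  have hder : ∀ x ∈ Set.Ioi (0 : ℝ),
      HasDerivWithinAt f (-(4 * x * (1 + x ^ 2)) / ((1 + x ^ 2) ^ 2) ^ 2) (Set.Ioi 0) x := by
    intro x hx
    have h1 : HasDerivAt (fun x : ℝ => (1 + x ^ 2) ^ 2) (4 * x * (1 + x ^ 2)) x := by
      have := ((hasDerivAt_pow 2 x).const_add 1).pow 2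
      refine this.congr_deriv ?_
      simp
      ring
    exact (h1.inv (by positivity)).hasDerivWithinAt
  have hinj : Set.InjOn f (Set.Ioi 0) := by
    intro x hx y hy h
    have hx0 : 0 < x := hx
    have hy0 : 0 < y := hy
    have h1 := inv_injective h
    have h2 := (pow_left_inj₀ (by positivity) (by positivity) two_ne_zero).1 h1
    have h3 : x ^ 2 = y ^ 2 := by linarith
    exact (pow_left_inj₀ hx0.le hy0.le two_ne_zero).1 h3
  have himg : f '' Set.Ioi 0 = Set.Ioo 0 1 := by
    ext t
    constructor
    · rintro ⟨x, hx, rfl⟩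
      have hx0 : 0 < x := hx
      refine ⟨by positivity, inv_lt_one_of_one_lt₀ ?_⟩
      nlinarith [sq_nonneg (x ^ 2), pow_pos hx0 2]
    · rintro ⟨h0, h1⟩
      have hs : 0 < √t := Real.sqrt_pos.2 h0
      have hs1 : √t < 1 := by rw [Real.sqrt_lt' one_pos]; simpa using h1
      have h2 : 0 < (√t)⁻¹ - 1 := by
        have := (one_lt_inv₀ hs).2 hs1
        linarith
      refine ⟨√((√t)⁻¹ - 1), Real.sqrt_pos.2 h2, ?_⟩
      simp only [hf]
      rw [Real.sq_sqrt h2.le, add_sub_cancel, inv_pow, Real.sq_sqrt h0.le, inv_inv]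
  have h := integral_image_eq_integral_abs_deriv_smul measurableSet_Ioi hder hinj
    (fun t : ℝ => t ^ (1 / 4 - 1 : ℝ) * (1 - t) ^ (1 / 2 - 1 : ℝ))
  have hbeta : ∫ t in Set.Ioo (0 : ℝ) 1, t ^ (1 / 4 - 1 : ℝ) * (1 - t) ^ (1 / 2 - 1 : ℝ) =
      ProbabilityTheory.beta (1 / 4) (1 / 2) := by
    rw [ProbabilityTheory.beta_eq_betaIntegralReal _ _ (by norm_num) (by norm_num),
      Complex.betaIntegral, intervalIntegral.integral_of_le zero_le_one,
      ← integral_Ioc_eq_integral_Ioo]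
    have hre : ∀ t ∈ Set.Ioc (0 : ℝ) 1, (t : ℂ) ^ (((1 / 4 : ℝ) : ℂ) - 1) *
        (1 - (t : ℂ)) ^ (((1 / 2 : ℝ) : ℂ) - 1) =
        ((t ^ (1 / 4 - 1 : ℝ) * (1 - t) ^ (1 / 2 - 1 : ℝ) : ℝ) : ℂ) := by
      intro t ht
      rw [Complex.ofReal_mul, Complex.ofReal_cpow ht.1.le,
        Complex.ofReal_cpow (sub_nonneg.2 ht.2)]
      push_cast
      rfl
    rw [setIntegral_congr_fun measurableSet_Ioc hre, integral_complex_ofReal,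
      Complex.ofReal_re]
  rw [himg, hbeta] at h
  have hintegral : ∫ x in Set.Ioi (0 : ℝ), |-(4 * x * (1 + x ^ 2)) / ((1 + x ^ 2) ^ 2) ^ 2| •
      ((f x) ^ (1 / 4 - 1 : ℝ) * (1 - f x) ^ (1 / 2 - 1 : ℝ)) =
      ∫ x in Set.Ioi (0 : ℝ), 4 * agmIntegrand √2 1 x := by
    refine setIntegral_congr_fun measurableSet_Ioi fun x hx => ?_
    have hx0 : 0 < x := hx
    set y : ℝ := 1 + x ^ 2 with hy
    have hy1 : 1 < y := by rw [hy]; nlinarith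
    have hy0 : 0 < y := by linarith
    have e1 : f x ^ (1 / 4 - 1 : ℝ) = y * √y := by
      simp only [hf, ← hy]
      rw [← Real.rpow_natCast, ← Real.rpow_neg hy0.le, ← Real.rpow_mul hy0.le, Real.sqrt_eq_rpow]
      nth_rewrite 2 [← Real.rpow_one y]
      rw [← Real.rpow_add hy0]
      norm_num
    have hx2 : 0 < x ^ 2 + 2 := by positivity
    have e2 : (1 - f x) ^ (1 / 2 - 1 : ℝ) = y / (x * √(x ^ 2 + 2)) := by
      have e3 : 1 - f x = (x * √(x ^ 2 + 2) / y) ^ 2 := by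
        simp only [hf, ← hy]
        rw [div_pow, mul_pow, Real.sq_sqrt hx2.le, hy]
        field_simp
        ring
      have hb : 0 < x * √(x ^ 2 + 2) / y := by positivity
      rw [e3, ← Real.rpow_natCast, ← Real.rpow_mul hb.le]
      norm_num
      rw [Real.rpow_neg_one, inv_div]
    have e4 : agmIntegrand √2 1 x = 1 / (√(x ^ 2 + 2) * √y) := by
      rw [agmIntegrand, Real.sq_sqrt (by norm_num), Real.sqrt_mul hx2.le, hy]
      ring_nf
    simp only [smul_eq_mul]
    rw [e1, e2, e4, neg_div, abs_neg, abs_of_pos (by positivity)]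
    have h1 : 0 < √(x ^ 2 + 2) := by positivity
    have h2 : 0 < √y := by positivity
    have h3 := Real.sq_sqrt hy0.le
    field_simp
    exact h3
  rw [hintegral, integral_const_mul] at h
  rw [agmIntegral_eq_two_mul]
  -- The reflection formula eliminates `Γ(3/4)`.
  have h1 : ProbabilityTheory.beta (1 / 4) (1 / 2) =
      Real.Gamma (1 / 4) ^ 2 * √Real.pi / (Real.pi * √2) := by
    have hG := Real.Gamma_mul_Gamma_one_sub (1 / 4)
    rw [show Real.pi * (1 / 4) = Real.pi / 4 by ring, Real.sin_pi_div_four,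
      show (1 - 1 / 4 : ℝ) = 3 / 4 by norm_num] at hG
    have hpos : 0 < Real.Gamma (1 / 4) := Real.Gamma_pos_of_pos (by norm_num)
    have hpos' : 0 < Real.Gamma (3 / 4) := Real.Gamma_pos_of_pos (by norm_num)
    have hs2 : (0 : ℝ) < √2 := by positivity
    have hs2' : √2 * √2 = (2 : ℝ) := Real.mul_self_sqrt (by norm_num)
    have hpi := Real.pi_pos
    rw [ProbabilityTheory.beta, Real.Gamma_one_half_eq,
      show (1 / 4 + 1 / 2 : ℝ) = 3 / 4 by norm_num]
    have hG' : Real.Gamma (1 / 4) * Real.Gamma (3 / 4) = Real.pi * √2 := by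
      rw [hG]
      field_simp
      linarith
    rw [← hG']
    field_simp
  rw [h1] at h
  have hs2 : (0 : ℝ) < √2 := by positivity
  have hpi := Real.pi_pos
  rw [show (2 : ℝ) * ∫ x in Set.Ioi (0 : ℝ), agmIntegrand √2 1 x =
    (4 * ∫ x in Set.Ioi (0 : ℝ), agmIntegrand √2 1 x) / 2 by ring, ← h]
  field_simp

/-! ### Theta series and their duplication formulas -/

/-- The theta series `∑ q ^ (n²)` over the integers. -/
noncomputable def theta (q : ℝ) : ℝ := ∑' n : ℤ, q ^ (n ^ 2)

/-- The theta series `∑ q ^ (n² + n)` over the integers. -/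
noncomputable def thetaOdd (q : ℝ) : ℝ := ∑' n : ℤ, q ^ (n ^ 2 + n)

lemma zpow_sq_eq_pow (q : ℝ) (n : ℤ) : q ^ (n ^ 2) = q ^ (n.natAbs ^ 2) := by
  rw [← zpow_natCast, Nat.cast_pow, Int.natAbs_sq]

lemma summable_pow_natAbs {q : ℝ} (h0 : 0 ≤ q) (h1 : q < 1) :
    Summable fun n : ℤ => q ^ n.natAbs := by
  refine Summable.of_nat_of_neg ?_ ?_ <;> simpa using summable_geometric_of_lt_one h0 h1

lemma summable_norm_zpow_sq {q : ℝ} (hq : |q| < 1) : Summable fun n : ℤ => ‖q ^ (n ^ 2)‖ := by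
  refine Summable.of_nonneg_of_le (fun _ => norm_nonneg _) (fun n => ?_)
    (summable_pow_natAbs (abs_nonneg q) hq)
  rw [zpow_sq_eq_pow, norm_pow, Real.norm_eq_abs]
  exact pow_le_pow_of_le_one (abs_nonneg q) hq.le (Nat.le_self_pow two_ne_zero _)

lemma summable_norm_zpow_sq_add {q : ℝ} (h0 : 0 < q) (hq : q < 1) :
    Summable fun n : ℤ => ‖q ^ (n ^ 2 + n)‖ := by
  refine ((summable_pow_natAbs h0.le hq).mul_right q⁻¹).of_nonneg_of_le
    (fun _ => norm_nonneg _) fun n => ?_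
  rw [Real.norm_eq_abs, abs_of_pos (by positivity), ← zpow_natCast, ← zpow_sub_one₀ h0.ne']
  refine zpow_le_zpow_right_of_le_one₀ h0 hq.le ?_
  rcases Int.natAbs_eq n with h | h <;> nlinarith [sq_nonneg ((n.natAbs : ℤ) - 1)]

lemma theta_mul_theta {x y : ℝ} (hx : |x| < 1) (hy : |y| < 1) :
    HasSum (fun p : ℤ × ℤ => x ^ (p.1 ^ 2) * y ^ (p.2 ^ 2)) (theta x * theta y) := by
  have h1 := summable_norm_zpow_sq hx
  have h2 := summable_norm_zpow_sq hy
  have h3 := (summable_mul_of_summable_norm h1 h2).hasSum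
  rwa [← tsum_mul_tsum_of_summable_norm h1 h2] at h3

/-- `(m, n) ↦ (m + n, m - n)` is a bijection from `ℤ²` onto the pairs with even sum. -/
lemma tsum_eq_tsum_even {g : ℤ × ℤ → ℝ} (hg : ∀ p : ℤ × ℤ, Odd (p.1 + p.2) → g p = 0) :
    ∑' p, g p = ∑' p : ℤ × ℤ, g (p.1 + p.2, p.1 - p.2) := by
  have hinj : Function.Injective fun p : ℤ × ℤ => (p.1 + p.2, p.1 - p.2) := by
    rintro ⟨a, b⟩ ⟨c, d⟩ h
    simp only [Prod.mk.injEq] at h ⊢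
    omega
  refine (hinj.tsum_eq (f := g) fun p hp => ?_).symm
  rcases Int.even_or_odd (p.1 + p.2) with ⟨k, hk⟩ | h
  · refine ⟨(k, k - p.2), ?_⟩
    ext <;> simp only <;> omega
  · exact absurd (hg p h) hp

lemma tsum_eq_tsum_odd {g : ℤ × ℤ → ℝ} (hg : ∀ p : ℤ × ℤ, Even (p.1 + p.2) → g p = 0) :
    ∑' p, g p = ∑' p : ℤ × ℤ, g (p.1 + p.2 + 1, p.1 - p.2) := by
  have hinj : Function.Injective fun p : ℤ × ℤ => (p.1 + p.2 + 1, p.1 - p.2) := by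
    rintro ⟨a, b⟩ ⟨c, d⟩ h
    simp only [Prod.mk.injEq] at h ⊢
    omega
  refine (hinj.tsum_eq (f := g) fun p hp => ?_).symm
  rcases Int.even_or_odd (p.1 + p.2) with h | ⟨k, hk⟩
  · exact absurd (hg p h) hp
  · refine ⟨(k, k - p.2), ?_⟩
    ext <;> simp only <;> omega

lemma even_sq_add_sq_iff (a b : ℤ) : Even (a ^ 2 + b ^ 2) ↔ Even (a + b) := by
  simp [Int.even_add, Int.even_pow]

lemma abs_sq_lt_one {q : ℝ} (hq : |q| < 1) : |q ^ 2| < 1 := by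
  rw [abs_pow]; exact pow_lt_one₀ (abs_nonneg q) hq two_ne_zero

/-- Pairs with odd sum cancel and the others double; on these the map `(m, n) ↦ (m + n, m - n)`
doubles the form `m² + n²`. This is the arithmetic mean in the AGM iteration, and
`theta_mul_theta_neg` is the geometric mean. -/
lemma theta_sq_add_theta_neg_sq {q : ℝ} (h0 : q ≠ 0) (hq : |q| < 1) :
    theta q ^ 2 + theta (-q) ^ 2 = 2 * theta (q ^ 2) ^ 2 := by
  have hn : |-q| < 1 := by rwa [abs_neg]
  have h1 := (theta_mul_theta hq hq).add (theta_mul_theta hn hn)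
  rw [sq, sq, sq, ← h1.tsum_eq, ← ((theta_mul_theta (abs_sq_lt_one hq)
    (abs_sq_lt_one hq)).mul_left 2).tsum_eq, tsum_eq_tsum_even]
  · refine tsum_congr fun p => ?_
    have he : (p.1 + p.2) ^ 2 + (p.1 - p.2) ^ 2 = 2 * (p.1 ^ 2 + p.2 ^ 2) := by ring
    rw [← zpow_add₀ h0, ← zpow_add₀ (neg_ne_zero.2 h0), ← zpow_add₀ (pow_ne_zero 2 h0), he,
      (even_two_mul _).neg_zpow, zpow_mul]
    norm_cast
    ring
  · intro p hp
    have : Odd (p.1 ^ 2 + p.2 ^ 2) := by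
      rwa [← Int.not_even_iff_odd, even_sq_add_sq_iff, Int.not_even_iff_odd]
    rw [← zpow_add₀ h0, ← zpow_add₀ (neg_ne_zero.2 h0), this.neg_zpow]
    ring

lemma theta_sq_sub_theta_neg_sq {q : ℝ} (h0 : 0 < q) (hq : q < 1) :
    theta q ^ 2 - theta (-q) ^ 2 = 2 * q * thetaOdd (q ^ 2) ^ 2 := by
  have hq' : |q| < 1 := by rwa [abs_of_pos h0]
  have hn : |-q| < 1 := by rwa [abs_neg]
  have hq2 : q ^ 2 < 1 := pow_lt_one₀ h0.le hq two_ne_zero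
  have h1 := (theta_mul_theta hq' hq').sub (theta_mul_theta hn hn)
  have hs := summable_norm_zpow_sq_add (pow_pos h0 2) hq2
  rw [sq, sq, sq, ← h1.tsum_eq, thetaOdd, tsum_mul_tsum_of_summable_norm hs hs, ← tsum_mul_left,
    tsum_eq_tsum_odd]
  · refine tsum_congr fun p => ?_
    have he : (p.1 + p.2 + 1) ^ 2 + (p.1 - p.2) ^ 2 =
        2 * (p.1 ^ 2 + p.1 + (p.2 ^ 2 + p.2)) + 1 := by ring
    rw [← zpow_add₀ h0.ne', ← zpow_add₀ (neg_ne_zero.2 h0.ne'), ← zpow_add₀ (pow_pos h0 2).ne', he,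
      (odd_two_mul_add_one _).neg_zpow, zpow_add_one₀ h0.ne', zpow_mul]
    norm_cast
    ring
  · intro p hp
    have : Even (p.1 ^ 2 + p.2 ^ 2) := by rwa [even_sq_add_sq_iff]
    rw [← zpow_add₀ h0.ne', ← zpow_add₀ (neg_ne_zero.2 h0.ne'), this.neg_zpow]
    ring

lemma theta_mul_theta_neg {q : ℝ} (h0 : q ≠ 0) (hq : |q| < 1) :
    theta q * theta (-q) = theta (-q ^ 2) ^ 2 := by
  have hn : |-q| < 1 := by rwa [abs_neg]
  have hn2 : |-q ^ 2| < 1 := by rw [abs_neg]; exact abs_sq_lt_one hq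
  have h1 := (theta_mul_theta hq hn).add (theta_mul_theta hn hq)
  -- Adding both orders makes the terms of odd index sum cancel.
  have key : theta q * theta (-q) + theta (-q) * theta q =
      2 * (theta (-q ^ 2) * theta (-q ^ 2)) := by
    rw [← h1.tsum_eq, ← ((theta_mul_theta hn2 hn2).mul_left 2).tsum_eq, tsum_eq_tsum_even]
    · refine tsum_congr fun p => ?_
      have he : (p.1 + p.2) ^ 2 + (p.1 - p.2) ^ 2 = 2 * (p.1 ^ 2 + p.2 ^ 2) := by ring
      have hpq : q ^ ((p.1 + p.2) ^ 2) * q ^ ((p.1 - p.2) ^ 2) =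
          (q ^ 2) ^ (p.1 ^ 2 + p.2 ^ 2) := by
        rw [← zpow_add₀ h0, he, zpow_mul]
        norm_cast
      rw [← zpow_add₀ (neg_ne_zero.2 (pow_ne_zero 2 h0))]
      rcases Int.even_or_odd (p.1 + p.2) with h | h
      · have h2 : Even (p.1 - p.2) := by
          rw [Int.even_sub]; rw [Int.even_add] at h; exact h
        rw [(h.pow_of_ne_zero two_ne_zero).neg_zpow, (h2.pow_of_ne_zero two_ne_zero).neg_zpow,
          ((even_sq_add_sq_iff _ _).2 h).neg_zpow, hpq]
        ring
      · have h2 : Odd (p.1 - p.2) := by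
          rw [Int.odd_sub']; rw [Int.odd_add'] at h; exact h
        have h3 : Odd (p.1 ^ 2 + p.2 ^ 2) := by
          rwa [← Int.not_even_iff_odd, even_sq_add_sq_iff, Int.not_even_iff_odd]
        rw [h.pow.neg_zpow, h2.pow.neg_zpow, h3.neg_zpow]
        linear_combination (-2) * hpq
    · intro p hp
      rcases Int.even_or_odd p.1 with h | h
      · have h2 : Odd p.2 := by
          rw [Int.odd_add'] at hp; exact hp.2 h
        rw [h2.pow.neg_zpow, (h.pow_of_ne_zero two_ne_zero).neg_zpow]
        ring
      · have h2 : Even p.2 := by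
          rw [Int.odd_add] at hp; exact hp.1 h
        rw [h.pow.neg_zpow, (h2.pow_of_ne_zero two_ne_zero).neg_zpow]
        ring
  linarith [key]

/-! ### Evaluation of the theta series at `e^{-π}` -/

lemma one_le_theta {q : ℝ} (h0 : 0 < q) (hq : q < 1) : 1 ≤ theta q := by
  have hq' : |q| < 1 := by rwa [abs_of_pos h0]
  have h := (summable_norm_zpow_sq hq').of_norm.hasSum
  have h2 := le_hasSum h 0 fun n _ => by positivity
  simpa only [theta, ne_eq, OfNat.ofNat_ne_zero, not_false_eq_true, zero_pow, zpow_zero]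
    using h2

lemma abs_theta_neg_le {q : ℝ} (h0 : 0 < q) (hq : q < 1) : |theta (-q)| ≤ theta q := by
  have hq' : |q| < 1 := by rwa [abs_of_pos h0]
  have hn : |-q| < 1 := by rwa [abs_neg]
  rw [theta, ← Real.norm_eq_abs]
  refine tsum_of_norm_bounded (summable_norm_zpow_sq hq').of_norm.hasSum fun n => ?_
  rw [norm_zpow, norm_neg, Real.norm_eq_abs, abs_of_pos h0]

lemma tendsto_theta_of_tendsto_zero {x : ℕ → ℝ} {q : ℝ} (h0 : 0 < q) (hq : q < 1)
    (hx : ∀ k, |x k| ≤ q) (hlim : Tendsto x atTop (𝓝 0)) :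
    Tendsto (fun k => theta (x k)) atTop (𝓝 1) := by
  have hq' : |q| < 1 := by rwa [abs_of_pos h0]
  have h := tendsto_tsum_of_dominated_convergence (𝓕 := atTop)
    (f := fun k (n : ℤ) => x k ^ (n ^ 2)) (g := fun n : ℤ => if n = 0 then (1 : ℝ) else 0)
    (summable_norm_zpow_sq hq') (fun n => ?_) (Eventually.of_forall fun k n => ?_)
  · simpa only [theta, tsum_ite_eq] using h
  · by_cases hn : n = 0
    · simp [hn]
    · simp only [hn, if_false, zpow_sq_eq_pow]
      have := hlim.pow (n.natAbs ^ 2)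
      rwa [zero_pow (by simpa using hn)] at this
  · rw [zpow_sq_eq_pow, zpow_sq_eq_pow, norm_pow, norm_pow]
    refine pow_le_pow_left₀ (norm_nonneg _) ?_ _
    rw [Real.norm_eq_abs, Real.norm_eq_abs, abs_of_pos h0]
    exact hx k

lemma pow_two_pow_le {q : ℝ} (h0 : 0 < q) (hq : q < 1) (k : ℕ) : q ^ 2 ^ k ≤ q :=
  pow_le_of_le_one h0.le hq.le (by positivity)

lemma tendsto_pow_two_pow {q : ℝ} (h0 : 0 < q) (hq : q < 1) :
    Tendsto (fun k : ℕ => q ^ 2 ^ k) atTop (𝓝 0) :=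
  (tendsto_pow_atTop_nhds_zero_of_lt_one h0.le hq).comp
    (tendsto_pow_atTop_atTop_of_one_lt one_lt_two)

lemma tendsto_theta_pow {q : ℝ} (h0 : 0 < q) (hq : q < 1) :
    Tendsto (fun k : ℕ => theta (q ^ 2 ^ k)) atTop (𝓝 1) :=
  tendsto_theta_of_tendsto_zero h0 hq
    (fun k => by rw [abs_of_pos (by positivity)]; exact pow_two_pow_le h0 hq k)
    (tendsto_pow_two_pow h0 hq)

lemma tendsto_theta_neg_pow {q : ℝ} (h0 : 0 < q) (hq : q < 1) :
    Tendsto (fun k : ℕ => theta (-q ^ 2 ^ k)) atTop (𝓝 1) :=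
  tendsto_theta_of_tendsto_zero h0 hq
    (fun k => by rw [abs_neg, abs_of_pos (by positivity)]; exact pow_two_pow_le h0 hq k)
    (by simpa using (tendsto_pow_two_pow h0 hq).neg)

/-- By `theta_mul_theta_neg` a zero at `-q` would propagate to every `-q^(2^k)`, where the values
tend to `1`. -/
lemma theta_neg_ne_zero {q : ℝ} (h0 : 0 < q) (hq : q < 1) : theta (-q) ≠ 0 := by
  intro h
  have hk : ∀ k : ℕ, theta (-q ^ 2 ^ k) = 0 := by
    intro k
    induction k with
    | zero => simpa using h
    | succ k ih =>
      have hpos : 0 < q ^ 2 ^ k := by positivity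
      have hlt : |q ^ 2 ^ k| < 1 := by
        rw [abs_of_pos hpos]; exact (pow_two_pow_le h0 hq k).trans_lt hq
      have := theta_mul_theta_neg hpos.ne' hlt
      rw [ih, mul_zero, ← pow_mul, ← pow_succ] at this
      exact pow_eq_zero_iff two_ne_zero |>.1 this.symm
  have := tendsto_theta_neg_pow h0 hq
  simp only [hk] at this
  exact zero_ne_one (tendsto_nhds_unique tendsto_const_nhds this)

lemma agmIntegral_theta_step {q : ℝ} (h0 : 0 < q) (hq : q < 1) :
    agmIntegral (theta (q ^ 2) ^ 2) (theta (-q ^ 2) ^ 2) =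
      agmIntegral (theta q ^ 2) (theta (-q) ^ 2) := by
  have hq' : |q| < 1 := by rwa [abs_of_pos h0]
  have ha : 0 < theta q ^ 2 := pow_pos (by linarith [one_le_theta h0 hq]) 2
  have hb : 0 < theta (-q) ^ 2 := by have := theta_neg_ne_zero h0 hq; positivity
  rw [← agmIntegral_step ha hb, theta_sq_add_theta_neg_sq h0.ne' hq', ← mul_pow,
    theta_mul_theta_neg h0.ne' hq', Real.sqrt_sq (by positivity)]
  congr 1
  ring

/-- Replacing `q` by `q²` is one AGM step, so the integral is constant along `q^(2^k)`, where both
parameters tend to `1`. -/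
lemma agmIntegral_theta {q : ℝ} (h0 : 0 < q) (hq : q < 1) :
    agmIntegral (theta q ^ 2) (theta (-q) ^ 2) = Real.pi := by
  have hconst : ∀ k : ℕ, agmIntegral (theta (q ^ 2 ^ k) ^ 2) (theta (-q ^ 2 ^ k) ^ 2) =
      agmIntegral (theta q ^ 2) (theta (-q) ^ 2) := by
    intro k
    induction k with
    | zero => simp
    | succ k ih =>
      rw [← ih, ← agmIntegral_theta_step (by positivity) ((pow_two_pow_le h0 hq k).trans_lt hq),
        ← pow_mul, ← pow_succ]
  have hmem : ∀ k : ℕ, agmIntegral (theta q ^ 2) (theta (-q) ^ 2) ∈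
      Set.Icc (Real.pi / theta (q ^ 2 ^ k) ^ 2) (Real.pi / theta (-q ^ 2 ^ k) ^ 2) := by
    intro k
    have hk0 : 0 < q ^ 2 ^ k := by positivity
    have hk1 : q ^ 2 ^ k < 1 := (pow_two_pow_le h0 hq k).trans_lt hq
    rw [← hconst k]
    refine agmIntegral_mem_Icc (by have := theta_neg_ne_zero hk0 hk1; positivity) ?_
    rw [sq_le_sq, abs_of_nonneg (a := theta (q ^ 2 ^ k)) (by linarith [one_le_theta hk0 hk1])]
    exact abs_theta_neg_le hk0 hk1
  have l1 : Tendsto (fun k : ℕ => Real.pi / theta (q ^ 2 ^ k) ^ 2) atTop (𝓝 Real.pi) := by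
    have h := (tendsto_const_nhds (x := Real.pi)).div ((tendsto_theta_pow h0 hq).pow 2) (by norm_num)
    rwa [one_pow, div_one] at h
  have l2 : Tendsto (fun k : ℕ => Real.pi / theta (-q ^ 2 ^ k) ^ 2) atTop (𝓝 Real.pi) := by
    have h := (tendsto_const_nhds (x := Real.pi)).div ((tendsto_theta_neg_pow h0 hq).pow 2) (by norm_num)
    rwa [one_pow, div_one] at h
  exact le_antisymm (ge_of_tendsto' l2 fun k => (hmem k).2)
    (le_of_tendsto' l1 fun k => (hmem k).1)

lemma theta_exp (a : ℝ) : theta (Real.exp (-Real.pi * a)) =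
    ∑' n : ℤ, Real.exp (-Real.pi * a * (n : ℝ) ^ 2) := by
  refine tsum_congr fun n => ?_
  rw [zpow_sq_eq_pow, ← Real.exp_nat_mul]
  push_cast
  rw [Nat.cast_natAbs, Int.cast_abs, sq_abs]
  ring_nf

/-- The functional equation of the theta series, relating the nomes `e^{-π/2}` and `e^{-2π}`. -/
lemma theta_exp_half_sq : theta (Real.exp (-(Real.pi / 2))) ^ 2 =
    2 * theta (Real.exp (-(2 * Real.pi))) ^ 2 := by
  have h := Real.tsum_exp_neg_mul_int_sq (a := 2) (by norm_num)
  rw [← theta_exp, ← Real.sqrt_eq_rpow] at h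
  have h2 := theta_exp (1 / 2)
  simp_rw [show -Real.pi * (1 / 2) = -Real.pi / 2 by ring] at h2
  rw [← h2] at h
  rw [show -(Real.pi / 2) = -Real.pi / 2 by ring, show -(2 * Real.pi) = -Real.pi * 2 by ring, h,
    mul_pow, div_pow, Real.sq_sqrt (by norm_num)]
  ring

lemma exp_neg_pi_lt_one : Real.exp (-Real.pi) < 1 := Real.exp_lt_one_iff.2 (by linarith [Real.pi_pos])

lemma exp_neg_pi_half_lt_one : Real.exp (-(Real.pi / 2)) < 1 :=
  Real.exp_lt_one_iff.2 (by linarith [Real.pi_pos])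

/-- Let `p = e^{-π/2}`, `q = p²`, `a = θ(q)²`, `b = θ(-q)²`. Duplication at `q` and the functional
equation give `θ(p)² = a + b`; duplication at `p` then gives `θ(-p)² = a - b`, and the product
formula gives `a² - b² = b²`. -/
lemma theta_exp_neg_pi_relations :
    theta (Real.exp (-Real.pi)) ^ 2 = √2 * theta (-Real.exp (-Real.pi)) ^ 2 ∧
    Real.exp (-(Real.pi / 2)) * thetaOdd (Real.exp (-Real.pi)) ^ 2 =
      theta (-Real.exp (-Real.pi)) ^ 2 := by
  have hp0 := Real.exp_pos (-(Real.pi / 2))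
  have hp1 := exp_neg_pi_half_lt_one
  have hq0 := Real.exp_pos (-Real.pi)
  have hq1 := exp_neg_pi_lt_one
  have hpq : Real.exp (-(Real.pi / 2)) ^ 2 = Real.exp (-Real.pi) := by
    rw [← Real.exp_nat_mul]; push_cast; ring_nf
  have hqq : Real.exp (-Real.pi) ^ 2 = Real.exp (-(2 * Real.pi)) := by
    rw [← Real.exp_nat_mul]; push_cast; ring_nf
  have e1 := theta_sq_add_theta_neg_sq hp0.ne' (by rwa [abs_of_pos hp0])
  have e2 := theta_mul_theta_neg hp0.ne' (by rwa [abs_of_pos hp0])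
  have e3 := theta_sq_sub_theta_neg_sq hp0 hp1
  have e4 := theta_sq_add_theta_neg_sq hq0.ne' (by rwa [abs_of_pos hq0])
  have e5 := theta_exp_half_sq
  have ha := one_le_theta hq0 hq1
  rw [hpq] at e1 e2 e3
  rw [hqq] at e4
  set p := Real.exp (-(Real.pi / 2))
  set q := Real.exp (-Real.pi)
  set a := theta q ^ 2
  set b := theta (-q) ^ 2 with hb
  have hb0 : 0 ≤ b := sq_nonneg _
  have ha0 : 0 ≤ a := sq_nonneg _
  have h1 : theta p ^ 2 = a + b := by linarith
  have h2 : theta (-p) ^ 2 = a - b := by linarith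
  have h3 : a ^ 2 = 2 * b ^ 2 := by
    have : theta p ^ 2 * theta (-p) ^ 2 = b ^ 2 := by rw [← mul_pow, e2]
    rw [h1, h2] at this
    linarith
  refine ⟨?_, by linarith⟩
  rw [← Real.sqrt_sq ha0, h3, Real.sqrt_mul (by norm_num), Real.sqrt_sq hb0]

/-- Homogeneity turns `agmIntegral (√2 b) b = π` into `b = agmIntegral √2 1 / π`. -/
lemma theta_neg_exp_neg_pi_sq : theta (-Real.exp (-Real.pi)) ^ 2 =
    Real.Gamma (1 / 4) ^ 2 * √Real.pi / (2 * Real.pi ^ 2 * √2) := by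
  have hpi := Real.pi_pos
  have h := agmIntegral_theta (Real.exp_pos (-Real.pi)) exp_neg_pi_lt_one
  have hne := theta_neg_ne_zero (Real.exp_pos (-Real.pi)) exp_neg_pi_lt_one
  rw [theta_exp_neg_pi_relations.1] at h
  set b := theta (-Real.exp (-Real.pi)) ^ 2
  have hb : 0 < b := by positivity
  have h2 := agmIntegral_smul (a := √2) (b := 1) hb
  rw [mul_one, mul_comm b, h, agmIntegral_sqrt_two_one] at h2
  have hs : (0 : ℝ) < √2 := by positivity
  field_simp at h2 ⊢
  linarith

/-! ### The `q`-binomial theorem -/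

/-- The finite product `∏ (1 - x ^ k)` over `1 ≤ k ≤ n`. -/
noncomputable def qPoch (x : ℝ) (n : ℕ) : ℝ := ∏ k ∈ range n, (1 - x ^ (k + 1))

/-- The Gaussian binomial coefficients, by the Pascal recursion. -/
noncomputable def qBinom (x : ℝ) : ℕ → ℕ → ℝ
  | _, 0 => 1
  | 0, _ + 1 => 0
  | n + 1, k + 1 => qBinom x n (k + 1) + x ^ (n - k) * qBinom x n k

lemma qBinom_zero_right (x : ℝ) (n : ℕ) : qBinom x n 0 = 1 := by
  cases n <;> rw [qBinom]

lemma qBinom_succ_succ (x : ℝ) (n k : ℕ) :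
    qBinom x (n + 1) (k + 1) = qBinom x n (k + 1) + x ^ (n - k) * qBinom x n k := by
  rw [qBinom]

lemma qBinom_eq_zero (x : ℝ) {n k : ℕ} (h : n < k) : qBinom x n k = 0 := by
  induction n generalizing k with
  | zero =>
    obtain ⟨k, rfl⟩ : ∃ l, k = l + 1 := ⟨k - 1, by omega⟩
    rw [qBinom]
  | succ n ih =>
    obtain ⟨k, rfl⟩ : ∃ l, k = l + 1 := ⟨k - 1, by omega⟩
    rw [qBinom_succ_succ, ih (by omega), ih (by omega)]
    ring

lemma qPoch_succ (x : ℝ) (n : ℕ) : qPoch x (n + 1) = qPoch x n * (1 - x ^ (n + 1)) := by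
  rw [qPoch, prod_range_succ, qPoch]

lemma qBinom_mul_qPoch (x : ℝ) {n k : ℕ} (h : k ≤ n) :
    qBinom x n k * (qPoch x k * qPoch x (n - k)) = qPoch x n := by
  induction n generalizing k with
  | zero =>
    obtain rfl : k = 0 := by omega
    simp [qPoch, qBinom_zero_right]
  | succ n ih =>
    rcases Nat.eq_zero_or_pos k with rfl | hk
    · simp [qPoch, qBinom_zero_right]
    obtain ⟨k, rfl⟩ : ∃ l, k = l + 1 := ⟨k - 1, by omega⟩
    rw [qBinom_succ_succ, Nat.add_sub_add_right]
    have h1 := ih (k := k) (by omega)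
    rcases Nat.eq_or_lt_of_le (show k ≤ n by omega) with rfl | hlt
    · rw [qBinom_eq_zero x (Nat.lt_succ_self _), qPoch_succ]
      simp only [Nat.sub_self, pow_zero] at h1 ⊢
      linear_combination (1 - x ^ (k + 1)) * h1
    · have h2 := ih (k := k + 1) (by omega)
      obtain ⟨m, hm⟩ : ∃ m, n - k = m + 1 := ⟨n - k - 1, by omega⟩
      rw [show n - (k + 1) = m by omega] at h2
      rw [hm] at h1 ⊢
      rw [qPoch_succ x n, qPoch_succ x m, qPoch_succ x k]
      rw [qPoch_succ] at h1 h2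
      have h3 : x ^ (m + 1) * x ^ (k + 1) = x ^ (n + 1) := by
        rw [← pow_add]; congr 1; omega
      linear_combination (1 - x ^ (m + 1)) * h2 + x ^ (m + 1) * (1 - x ^ (k + 1)) * h1 -
        qPoch x n * h3

lemma prod_one_add_mul_pow (x y : ℝ) (n : ℕ) :
    ∏ k ∈ range n, (1 + y * x ^ k) =
      ∑ k ∈ range (n + 1), qBinom x n k * x ^ (k.choose 2) * y ^ k := by
  induction n with
  | zero => simp [qBinom_zero_right]
  | succ n ih =>
    rw [prod_range_succ, ih, sum_range_succ' _ (n + 1)]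
    have h1 : ∑ k ∈ range (n + 1), qBinom x (n + 1) (k + 1) * x ^ ((k + 1).choose 2) * y ^ (k + 1) =
        ∑ k ∈ range (n + 1), qBinom x n (k + 1) * x ^ ((k + 1).choose 2) * y ^ (k + 1) +
        y * x ^ n * ∑ k ∈ range (n + 1), qBinom x n k * x ^ (k.choose 2) * y ^ k := by
      rw [mul_sum, ← sum_add_distrib]
      refine sum_congr rfl fun k hk => ?_
      have hk' : k ≤ n := by simpa [Nat.lt_succ_iff] using hk
      have h2 : x ^ (n - k) * x ^ ((k + 1).choose 2) = x ^ n * x ^ (k.choose 2) := by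
        have h3 : (k + 1).choose 2 = k + k.choose 2 := by
          rw [Nat.choose_succ_succ' k 1, Nat.choose_one_right]
        rw [← pow_add, ← pow_add, h3]
        congr 1
        omega
      rw [qBinom_succ_succ]
      linear_combination (qBinom x n k * y ^ (k + 1)) * h2
    have h3 := sum_range_succ' (fun k => qBinom x n k * x ^ (k.choose 2) * y ^ k) (n + 1)
    rw [sum_range_succ, qBinom_eq_zero x (Nat.lt_succ_self n)] at h3
    simp only [qBinom_zero_right] at h3 ⊢
    rw [h1]
    linear_combination h3

lemma prod_range_zpow_odd {q z : ℝ} (hq : q ≠ 0) (n : ℕ) :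
    ∏ i ∈ range n, (z * q ^ (-(2 * (i : ℤ) + 1))) = z ^ n * q ^ (-(n : ℤ) ^ 2) := by
  induction n with
  | zero => simp
  | succ n ih =>
    rw [prod_range_succ, ih, show -((n + 1 : ℕ) : ℤ) ^ 2 = -(n : ℤ) ^ 2 + -(2 * (n : ℤ) + 1) by
      push_cast; ring, zpow_add₀ hq]
    ring

/-- The finite form of the Jacobi triple product. -/
lemma finite_triple_product {q z : ℝ} (hq : q ≠ 0) (hz : z ≠ 0) (n : ℕ) :
    ∏ k ∈ range n, ((1 + z * q ^ (2 * k + 1)) * (1 + z⁻¹ * q ^ (2 * k + 1))) =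
      ∑ k ∈ range (2 * n + 1), qBinom (q ^ 2) (2 * n) k *
        (q ^ (((k : ℤ) - n) ^ 2) * z ^ ((k : ℤ) - n)) := by
  -- With base `q²` and this shift the exponents run over the odd numbers from `1 - 2n` to `2n - 1`;
  -- the negative half is then reflected.
  have h := prod_one_add_mul_pow (q ^ 2) (z * q ^ (1 - 2 * (n : ℤ))) (2 * n)
  have e1 : ∏ k ∈ range (2 * n), (1 + z * q ^ (1 - 2 * (n : ℤ)) * (q ^ 2) ^ k) =
      z ^ n * q ^ (-(n : ℤ) ^ 2) *
      ∏ k ∈ range n, ((1 + z * q ^ (2 * k + 1)) * (1 + z⁻¹ * q ^ (2 * k + 1))) := by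
    have hneg : ∏ k ∈ range n, (1 + z * q ^ (1 - 2 * (n : ℤ)) * (q ^ 2) ^ k) =
        z ^ n * q ^ (-(n : ℤ) ^ 2) * ∏ k ∈ range n, (1 + z⁻¹ * q ^ (2 * k + 1)) := by
      rw [← prod_range_reflect, ← prod_range_zpow_odd hq, ← prod_mul_distrib]
      refine prod_congr rfl fun i hi => ?_
      have hi' : i < n := mem_range.1 hi
      have e2 : q ^ (1 - 2 * (n : ℤ)) * (q ^ 2) ^ (n - 1 - i) = q ^ (-(2 * (i : ℤ) + 1)) := by
        rw [← pow_mul, ← zpow_natCast, ← zpow_add₀ hq]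
        congr 1
        push_cast [Nat.sub_sub, Nat.cast_sub (show 1 + i ≤ n by omega)]
        ring
      have e3 : q ^ (-(2 * (i : ℤ) + 1)) * q ^ (2 * i + 1) = 1 := by
        rw [← zpow_natCast, ← zpow_add₀ hq]
        push_cast
        simp
      rw [mul_assoc, e2]
      have : z * z⁻¹ = 1 := mul_inv_cancel₀ hz
      linear_combination (-1 : ℝ) * e3 - q ^ (-(2 * (i : ℤ) + 1)) * q ^ (2 * i + 1) * this
    have hpos : ∏ k ∈ range n, (1 + z * q ^ (1 - 2 * (n : ℤ)) * (q ^ 2) ^ (n + k)) =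
        ∏ k ∈ range n, (1 + z * q ^ (2 * k + 1)) := by
      refine prod_congr rfl fun i _ => ?_
      rw [mul_assoc, ← pow_mul, ← zpow_natCast, ← zpow_natCast, ← zpow_add₀ hq]
      congr 3
      push_cast
      ring
    rw [two_mul, prod_range_add, prod_mul_distrib, hneg, hpos]
    ring
  have hne : z ^ n * q ^ (-(n : ℤ) ^ 2) ≠ 0 := by positivity
  rw [e1] at h
  apply mul_left_cancel₀ hne
  rw [h, mul_sum]
  refine sum_congr rfl fun k _ => ?_
  have e4 : (q ^ 2) ^ (k.choose 2) * (z * q ^ (1 - 2 * (n : ℤ))) ^ k =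
      z ^ n * q ^ (-(n : ℤ) ^ 2) * (q ^ (((k : ℤ) - n) ^ 2) * z ^ ((k : ℤ) - n)) := by
    have hk : ((2 * k.choose 2 : ℕ) : ℤ) = k * (k - 1) := by
      rw [Nat.choose_two_right, Nat.mul_div_cancel' (Nat.even_mul_pred_self k).two_dvd]
      cases k <;> simp
    rw [mul_pow, ← pow_mul, ← zpow_natCast q, hk, ← zpow_natCast (q ^ _), ← zpow_mul,
      ← zpow_natCast z n, ← zpow_natCast z k,
      show q ^ ((k : ℤ) * (k - 1)) * (z ^ (k : ℤ) * q ^ ((1 - 2 * (n : ℤ)) * k)) =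
        z ^ (k : ℤ) * (q ^ ((k : ℤ) * (k - 1)) * q ^ ((1 - 2 * (n : ℤ)) * k)) by ring,
      show z ^ (n : ℤ) * q ^ (-(n : ℤ) ^ 2) * (q ^ (((k : ℤ) - n) ^ 2) * z ^ ((k : ℤ) - n)) =
        z ^ (n : ℤ) * z ^ ((k : ℤ) - n) * (q ^ (-(n : ℤ) ^ 2) * q ^ (((k : ℤ) - n) ^ 2)) by ring,
      ← zpow_add₀ hq, ← zpow_add₀ hq, ← zpow_add₀ hz]
    ring_nf
  rw [mul_assoc, e4]
  ring

/-! ### The Euler product and the triple product -/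

/-- The Euler product `∏ (1 - x ^ k)` over `k ≥ 1`, for `0 < x < 1`. -/
noncomputable def eulerProd (x : ℝ) : ℝ := Real.exp (∑' k : ℕ, Real.log (1 - x ^ (k + 1)))

lemma eulerProd_pos (x : ℝ) : 0 < eulerProd x := Real.exp_pos _

lemma one_sub_pow_succ_pos {x : ℝ} (h0 : 0 < x) (h1 : x < 1) (k : ℕ) : 0 < 1 - x ^ (k + 1) :=
  sub_pos.2 (pow_lt_one₀ h0.le h1 (Nat.succ_ne_zero k))

lemma summable_log_one_sub_pow {x : ℝ} (h0 : 0 < x) (h1 : x < 1) :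
    Summable fun k : ℕ => Real.log (1 - x ^ (k + 1)) := by
  have h := ((summable_nat_add_iff 1).2 (summable_geometric_of_lt_one h0.le h1)).neg
  simpa [sub_eq_add_neg] using Real.summable_log_one_add_of_summable h

lemma tendsto_qPoch {x : ℝ} (h0 : 0 < x) (h1 : x < 1) :
    Tendsto (qPoch x) atTop (𝓝 (eulerProd x)) :=
  (Real.hasProd_of_hasSum_log (one_sub_pow_succ_pos h0 h1)
    (summable_log_one_sub_pow h0 h1).hasSum).tendsto_prod_nat

lemma qPoch_antitone {x : ℝ} (h0 : 0 < x) (h1 : x < 1) : Antitone (qPoch x) := by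
  refine antitone_nat_of_succ_le fun n => ?_
  rw [qPoch_succ]
  refine mul_le_of_le_one_right (prod_nonneg fun k _ => (one_sub_pow_succ_pos h0 h1 k).le) ?_
  linarith [pow_pos h0 (n + 1)]

lemma eulerProd_le_qPoch {x : ℝ} (h0 : 0 < x) (h1 : x < 1) (n : ℕ) : eulerProd x ≤ qPoch x n :=
  (qPoch_antitone h0 h1).le_of_tendsto (tendsto_qPoch h0 h1) n

lemma qPoch_le_one {x : ℝ} (h0 : 0 < x) (h1 : x < 1) (n : ℕ) : qPoch x n ≤ 1 := by
  simpa [qPoch] using qPoch_antitone h0 h1 (Nat.zero_le n)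

lemma qBinom_eq_div {x : ℝ} (h0 : 0 < x) (h1 : x < 1) {n k : ℕ} (h : k ≤ n) :
    qBinom x n k = qPoch x n / (qPoch x k * qPoch x (n - k)) := by
  have hpos := fun m => (eulerProd_pos x).trans_le (eulerProd_le_qPoch h0 h1 m)
  rw [eq_div_iff (mul_pos (hpos _) (hpos _)).ne', qBinom_mul_qPoch x h]

/-- Every `qPoch` lies between `eulerProd x` and `1`. Uniformity in `n` and `k` provides the
dominating series for the limit of the finite triple product. -/
lemma abs_qBinom_le {x : ℝ} (h0 : 0 < x) (h1 : x < 1) {n k : ℕ} (h : k ≤ n) :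
    |qBinom x n k| ≤ 1 / (eulerProd x * eulerProd x) := by
  have hpos := fun m => (eulerProd_pos x).trans_le (eulerProd_le_qPoch h0 h1 m)
  have he := eulerProd_pos x
  rw [qBinom_eq_div h0 h1 h, abs_of_pos (div_pos (hpos _) (mul_pos (hpos _) (hpos _)))]
  exact div_le_div₀ zero_le_one (qPoch_le_one h0 h1 n) (mul_pos he he)
    (mul_le_mul (eulerProd_le_qPoch h0 h1 k) (eulerProd_le_qPoch h0 h1 _) he.le (hpos k).le)

/-- The Jacobi triple product. -/
lemma tendsto_triple_product {q z : ℝ} (h0 : 0 < q) (h1 : q < 1) (hz : z ≠ 0)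
    (hs : Summable fun j : ℤ => ‖q ^ (j ^ 2) * z ^ j‖) :
    Tendsto (fun n : ℕ => ∏ k ∈ range n,
      ((1 + z * q ^ (2 * k + 1)) * (1 + z⁻¹ * q ^ (2 * k + 1)))) atTop
      (𝓝 ((∑' j : ℤ, q ^ (j ^ 2) * z ^ j) / eulerProd (q ^ 2))) := by
  have hx0 : 0 < q ^ 2 := by positivity
  have hx1 : q ^ 2 < 1 := pow_lt_one₀ h0.le h1 two_ne_zero
  have he := eulerProd_pos (q ^ 2)
  -- The finite sum recentred by `k = j + n` and extended by zero to all of `ℤ`.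
  set f : ℕ → ℤ → ℝ := fun n j => if j ∈ Icc (-(n : ℤ)) n then
    qBinom (q ^ 2) (2 * n) (j + n).toNat * (q ^ (j ^ 2) * z ^ j) else 0 with hf
  have hsum : ∀ n : ℕ, ∏ k ∈ range n,
      ((1 + z * q ^ (2 * k + 1)) * (1 + z⁻¹ * q ^ (2 * k + 1))) = ∑' j, f n j := by
    intro n
    rw [tsum_eq_sum (s := Icc (-(n : ℤ)) n) (fun j hj => if_neg hj),
      finite_triple_product h0.ne' hz]
    refine sum_bij' (fun k _ => (k : ℤ) - n) (fun j _ => (j + n).toNat) ?_ ?_ ?_ ?_ ?_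
    · intro k hk; rw [mem_range] at hk; rw [mem_Icc]; omega
    · intro j hj; rw [mem_Icc] at hj; rw [mem_range]; omega
    · intro k hk; simp
    · intro j hj; rw [mem_Icc] at hj; omega
    · intro k hk
      rw [mem_range] at hk
      rw [if_pos (by rw [mem_Icc]; omega), show ((k : ℤ) - n + n).toNat = k by omega]
  simp_rw [hsum, ← tsum_div_const]
  refine tendsto_tsum_of_dominated_convergence
    (bound := fun j : ℤ => 1 / (eulerProd (q ^ 2) * eulerProd (q ^ 2)) * ‖q ^ (j ^ 2) * z ^ j‖)
    (hs.mul_left _) (fun j => ?_) (Eventually.of_forall fun n j => ?_)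
  · have hev : ∀ᶠ n : ℕ in atTop, qPoch (q ^ 2) (2 * n) / (qPoch (q ^ 2) (j + n).toNat *
        qPoch (q ^ 2) (n - j).toNat) * (q ^ (j ^ 2) * z ^ j) = f n j := by
      filter_upwards [eventually_ge_atTop j.natAbs] with n hn
      rw [hf]
      simp only
      rw [if_pos (by rw [mem_Icc]; omega), qBinom_eq_div hx0 hx1 (by omega),
        show 2 * n - (j + n).toNat = (n - j).toNat by omega]
    refine Tendsto.congr' hev ?_
    have l := tendsto_qPoch hx0 hx1
    have t1 : Tendsto (fun n : ℕ => 2 * n) atTop atTop :=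
      tendsto_atTop_mono (fun n => by simp only [id]; omega) tendsto_id
    have t2 : Tendsto (fun n : ℕ => (j + n).toNat) atTop atTop := by
      rw [tendsto_atTop]
      intro b
      filter_upwards [eventually_ge_atTop (b + j.natAbs)] with n hn
      omega
    have t3 : Tendsto (fun n : ℕ => ((n : ℤ) - j).toNat) atTop atTop := by
      rw [tendsto_atTop]
      intro b
      filter_upwards [eventually_ge_atTop (b + j.natAbs)] with n hn
      omega
    have := (((l.comp t1).div ((l.comp t2).mul (l.comp t3)) (mul_pos he he).ne')).mul_const
      (q ^ (j ^ 2) * z ^ j)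
    rw [show eulerProd (q ^ 2) / (eulerProd (q ^ 2) * eulerProd (q ^ 2)) * (q ^ (j ^ 2) * z ^ j) =
      q ^ (j ^ 2) * z ^ j / eulerProd (q ^ 2) by field_simp] at this
    exact this
  · rw [hf]
    simp only
    split_ifs with h
    · rw [norm_mul]
      rw [mem_Icc] at h
      exact mul_le_mul_of_nonneg_right (abs_qBinom_le hx0 hx1 (by omega)) (norm_nonneg _)
    · rw [norm_zero]
      positivity

/-- In the limit this is Euler's identity `∏ (1 - x^{2k-1})(1 + x^k) = 1`. -/
lemma qPoch_two_mul (x : ℝ) (n : ℕ) :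
    qPoch x (2 * n) =
      (∏ k ∈ range n, ((1 - x ^ (2 * k + 1)) * (1 + x ^ (k + 1)))) * qPoch x n := by
  induction n with
  | zero => simp [qPoch]
  | succ n ih =>
    rw [show 2 * (n + 1) = 2 * n + 1 + 1 by ring, qPoch_succ, qPoch_succ, ih, prod_range_succ,
      qPoch_succ]
    ring

/-- The factor `k = 0` equals `2`; this is the source of the `2` in the product of the three theta
constants. -/
lemma prod_one_add_pow_shift (q : ℝ) (n : ℕ) :
    (∏ k ∈ range n, (1 + q ^ (2 * k))) * (1 + q ^ (2 * n)) =
      2 * ∏ k ∈ range n, (1 + q ^ (2 * k + 2)) := by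
  rw [← prod_range_succ (fun k => 1 + q ^ (2 * k)), prod_range_succ']
  norm_num [mul_add]
  ring

/-- The product of the three theta constants. -/
lemma theta_mul_theta_neg_mul_thetaOdd {q : ℝ} (h0 : 0 < q) (h1 : q < 1) :
    theta q * theta (-q) * thetaOdd q = 2 * eulerProd (q ^ 2) ^ 3 := by
  have hx0 : 0 < q ^ 2 := by positivity
  have hx1 : q ^ 2 < 1 := pow_lt_one₀ h0.le h1 two_ne_zero
  have hq' : |q| < 1 := by rwa [abs_of_pos h0]
  have he := eulerProd_pos (q ^ 2)
  have hsq := summable_norm_zpow_sq hq'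
  have eodd : ∀ j : ℤ, q ^ (j ^ 2) * q ^ j = q ^ (j ^ 2 + j) := fun j => (zpow_add₀ h0.ne' _ _).symm
  have eneg : ∀ j : ℤ, q ^ (j ^ 2) * (-1 : ℝ) ^ j = (-q) ^ (j ^ 2) := by
    intro j
    rcases Int.even_or_odd j with h | h
    · rw [h.neg_one_zpow, (h.pow_of_ne_zero two_ne_zero).neg_zpow, mul_one]
    · rw [h.neg_one_zpow, h.pow.neg_zpow]
      ring
  have l1 := tendsto_triple_product h0 h1 (z := 1) one_ne_zero (by simpa using hsq)
  have l2 := tendsto_triple_product h0 h1 (z := -1) (by norm_num) (by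
    simp_rw [eneg]
    exact summable_norm_zpow_sq (by rwa [abs_neg]))
  have l3 := tendsto_triple_product h0 h1 (z := q) h0.ne' (by
    simp_rw [eodd]
    exact summable_norm_zpow_sq_add h0 h1)
  simp_rw [one_zpow, mul_one] at l1
  simp_rw [eneg] at l2
  simp_rw [eodd] at l3
  have l4 : Tendsto (fun n : ℕ => 1 + q ^ (2 * n)) atTop (𝓝 1) := by
    have := (tendsto_pow_atTop_nhds_zero_of_lt_one hx0.le hx1).const_add 1
    simpa [pow_mul] using this
  have hinner : Tendsto (fun n : ℕ => ∏ k ∈ range n, ((1 - (q ^ 2) ^ (2 * k + 1)) *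
      (1 + (q ^ 2) ^ (k + 1)))) atTop (𝓝 1) := by
    have t1 : Tendsto (fun n : ℕ => 2 * n) atTop atTop :=
      tendsto_atTop_mono (fun n => by simp only [id]; omega) tendsto_id
    have l := tendsto_qPoch hx0 hx1
    have := (l.comp t1).div l he.ne'
    rw [div_self he.ne'] at this
    refine this.congr fun n => ?_
    have hpos := he.trans_le (eulerProd_le_qPoch hx0 hx1 n)
    simp only [Pi.div_apply, Function.comp_apply]
    rw [qPoch_two_mul, mul_div_assoc, div_self hpos.ne', mul_one]
  -- The extra factor `1 + q^{2n}`, with limit `1`, makes the identity exact for each `n`.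
  have hlhs := ((l1.mul l2).mul l3).mul l4
  have hrhs := (hinner.pow 2).const_mul 2
  have heq := tendsto_nhds_unique hlhs (hrhs.congr fun n => ?_)
  · change theta q / eulerProd (q ^ 2) * (theta (-q) / eulerProd (q ^ 2)) *
      (thetaOdd q / eulerProd (q ^ 2)) * 1 = 2 * 1 ^ 2 at heq
    field_simp at heq
    linarith
  · have e1 : ∏ k ∈ range n, ((1 + q * q ^ (2 * k + 1)) * (1 + q⁻¹ * q ^ (2 * k + 1))) =
        (∏ k ∈ range n, (1 + q ^ (2 * k + 2))) * ∏ k ∈ range n, (1 + q ^ (2 * k)) := by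
      rw [← prod_mul_distrib]
      refine prod_congr rfl fun k _ => ?_
      rw [pow_succ q (2 * k)]
      field_simp
      ring
    have e2 := prod_one_add_pow_shift q n
    have e3 : ∏ k ∈ range n, ((1 - (q ^ 2) ^ (2 * k + 1)) * (1 + (q ^ 2) ^ (k + 1))) =
        (∏ k ∈ range n, (1 + q ^ (2 * k + 1))) * (∏ k ∈ range n, (1 - q ^ (2 * k + 1))) *
          ∏ k ∈ range n, (1 + q ^ (2 * k + 2)) := by
      rw [← prod_mul_distrib, ← prod_mul_distrib]
      refine prod_congr rfl fun k _ => ?_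
      ring
    have e4 : ∏ k ∈ range n, ((1 + 1 * q ^ (2 * k + 1)) * (1 + 1⁻¹ * q ^ (2 * k + 1))) =
        (∏ k ∈ range n, (1 + q ^ (2 * k + 1))) ^ 2 := by
      rw [sq, ← prod_mul_distrib]
      simp
    have e5 : ∏ k ∈ range n, ((1 + -1 * q ^ (2 * k + 1)) * (1 + (-1)⁻¹ * q ^ (2 * k + 1))) =
        (∏ k ∈ range n, (1 - q ^ (2 * k + 1))) ^ 2 := by
      rw [sq, ← prod_mul_distrib]
      refine prod_congr rfl fun k _ => ?_
      norm_num
      ring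
    rw [e1, e3, e4, e5]
    linear_combination (-(∏ k ∈ range n, (1 + q ^ (2 * k + 1))) ^ 2 *
      (∏ k ∈ range n, (1 - q ^ (2 * k + 1))) ^ 2 * ∏ k ∈ range n, (1 + q ^ (2 * k + 2))) * e2

/-! ### Evaluation of the exponential series -/

/-- Expand each `-log (1 - x^k)` as `∑ x^{kj}/j`, interchange the sums of positive terms, and sum
the geometric series in `k`. -/
lemma expSeries_eq : expSeries = -Real.log (eulerProd (Real.exp (-(2 * Real.pi)))) := by
  have hpi := Real.pi_pos
  set x := Real.exp (-(2 * Real.pi)) with hx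
  have h0 : 0 < x := Real.exp_pos _
  have h1 : x < 1 := Real.exp_lt_one_iff.2 (by linarith)
  have hpow : ∀ k : ℕ, 0 < x ^ (k + 1) ∧ x ^ (k + 1) < 1 := fun k =>
    ⟨by positivity, pow_lt_one₀ h0.le h1 (Nat.succ_ne_zero k)⟩
  have hrow : ∀ k : ℕ, HasSum (fun j : ℕ => x ^ ((k + 1) * (j + 1)) / ((j : ℝ) + 1))
      (-Real.log (1 - x ^ (k + 1))) := by
    intro k
    have := Real.hasSum_pow_div_log_of_abs_lt_one (x := x ^ (k + 1))
      (by rw [abs_of_pos (hpow k).1]; exact (hpow k).2)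
    simpa only [← pow_mul] using this
  have hsum : Summable fun p : ℕ × ℕ => x ^ ((p.1 + 1) * (p.2 + 1)) / ((p.2 : ℝ) + 1) := by
    rw [summable_prod_of_nonneg (fun p => by positivity)]
    refine ⟨fun k => (hrow k).summable, ?_⟩
    simp_rw [(hrow _).tsum_eq]
    exact (summable_log_one_sub_pow h0 h1).neg
  have hcol : ∀ j : ℕ, ∑' k : ℕ, x ^ ((k + 1) * (j + 1)) / ((j : ℝ) + 1) =
      1 / (((j + 1 : ℕ) : ℝ) * (Real.exp (2 * Real.pi * ((j + 1 : ℕ) : ℝ)) - 1)) := by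
    intro j
    have e1 : ∀ k : ℕ, x ^ ((k + 1) * (j + 1)) / ((j : ℝ) + 1) =
        x ^ (j + 1) / ((j : ℝ) + 1) * (x ^ (j + 1)) ^ k := by
      intro k
      rw [← pow_mul, div_mul_eq_mul_div, ← pow_add]
      congr 2
      ring
    have hX : Real.exp (2 * Real.pi * ((j + 1 : ℕ) : ℝ)) = (x ^ (j + 1))⁻¹ := by
      rw [hx, ← Real.exp_nat_mul, ← Real.exp_neg]
      ring_nf
    simp_rw [e1]
    rw [tsum_mul_left, tsum_geometric_of_lt_one (hpow j).1.le (hpow j).2, hX]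
    have h2 := hpow j
    set y := x ^ (j + 1)
    have h3 : y⁻¹ - 1 = (1 - y) / y := by have := h2.1; field_simp
    have h4 : 1 - y ≠ 0 := by linarith [h2.2]
    have h5 := h2.1
    rw [h3]
    push_cast
    field_simp
  rw [eulerProd, Real.log_exp, ← tsum_neg, expSeries]
  simp_rw [← hcol, ← (hrow _).tsum_eq]
  exact (Summable.tsum_comm (f := fun k j : ℕ => x ^ ((k + 1) * (j + 1)) / ((j : ℝ) + 1)) hsum)

/-- Squaring the theta product at `e^{-π}` and multiplying by `p = e^{-π/2}` gives `4 P⁶ p = √2 b³`.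
Taking logarithms, `log p = -π/2` becomes the term `-π/3`. -/
lemma four_mul_expSeries :
    4 * expSeries = Real.log (16 * Real.pi ^ 3 / Real.Gamma (1 / 4) ^ 4) - Real.pi / 3 := by
  have hpi := Real.pi_pos
  have hG : 0 < Real.Gamma (1 / 4) := Real.Gamma_pos_of_pos (by norm_num)
  have h1 := theta_mul_theta_neg_mul_thetaOdd (Real.exp_pos (-Real.pi)) exp_neg_pi_lt_one
  obtain ⟨h2, h3⟩ := theta_exp_neg_pi_relations
  have h4 := theta_neg_exp_neg_pi_sq
  rw [show Real.exp (-Real.pi) ^ 2 = Real.exp (-(2 * Real.pi)) by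
    rw [← Real.exp_nat_mul]; push_cast; ring_nf] at h1
  rw [expSeries_eq]
  have hP := eulerProd_pos (Real.exp (-(2 * Real.pi)))
  set P := eulerProd (Real.exp (-(2 * Real.pi)))
  set q := Real.exp (-Real.pi)
  set p := Real.exp (-(Real.pi / 2)) with hp
  set b := theta (-q) ^ 2
  have hb : 0 < b := by rw [h4]; positivity
  have h5 : 4 * P ^ 6 * p = √2 * b ^ 3 := by
    calc 4 * P ^ 6 * p = (theta q * theta (-q) * thetaOdd q) ^ 2 * p := by rw [h1]; ring
      _ = theta q ^ 2 * b * (p * thetaOdd q ^ 2) := by ring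
      _ = √2 * b ^ 3 := by rw [h2, h3]; ring
  have h6 := congrArg Real.log h5
  have hb2 : b ^ 2 = Real.Gamma (1 / 4) ^ 4 / (8 * Real.pi ^ 3) := by
    rw [h4, div_pow, mul_pow, mul_pow, Real.sq_sqrt hpi.le, mul_pow, Real.sq_sqrt (by norm_num)]
    field_simp
    ring
  have h7 : 16 * Real.pi ^ 3 / Real.Gamma (1 / 4) ^ 4 = 2 / b ^ 2 := by
    rw [hb2]
    field_simp
    ring
  rw [Real.log_mul (by positivity) (by positivity), Real.log_mul (by positivity) (by positivity),
    Real.log_mul (by positivity) (by positivity), Real.log_pow, Real.log_pow, hp, Real.log_exp,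
    Real.log_sqrt (by norm_num), show (4 : ℝ) = 2 ^ 2 by norm_num, Real.log_pow] at h6
  rw [h7, Real.log_div (by norm_num) (by positivity), Real.log_pow]
  push_cast at h6 ⊢
  linarith

/-! ### The asymptotic expansion -/

lemma exists_abs_sum_summandB2_sub_le :
    ∃ C : ℝ, ∀ n : ℕ, 0 < n → |∑ p ∈ (range n ×ˢ range n).erase (0, 0), summandB2 n p -
      (4 / (3 * Real.pi) * (n : ℝ) ^ 2 * Real.log n +
        2 / (3 * Real.pi) * (2 * Real.eulerMascheroniConstant +
          Real.log (96 * Real.pi / Real.Gamma (1 / 4) ^ 4)) * (n : ℝ) ^ 2)| ≤ C := by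
  obtain ⟨C, hC⟩ := exists_abs_sum_rowWeight_sub_le
  obtain ⟨D, hD⟩ := exists_abs_sum_corr_sub_le
  refine ⟨2 / 9 + 2 / 3 * C + 2 / 3 * D, fun n hn => ?_⟩
  have hpi := Real.pi_pos
  have hn' : (0 : ℝ) < n := by exact_mod_cast hn
  have hG : 0 < Real.Gamma (1 / 4) := Real.Gamma_pos_of_pos (by norm_num)
  have h1 := hC n hn
  have h2 := hD n hn
  -- The summand `π/3` carries the coefficient `2/(3π)` and so accounts for the `2n²/9` of the row
  -- through the origin.
  have hlog : Real.log (96 * Real.pi / Real.Gamma (1 / 4) ^ 4) = 2 * Real.log (2 / Real.pi) +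
      Real.log (3 / 2) + (4 * expSeries + Real.pi / 3) := by
    rw [four_mul_expSeries, sub_add_cancel,
      show 96 * Real.pi / Real.Gamma (1 / 4) ^ 4 = (2 / Real.pi) ^ 2 * (3 / 2) *
        (16 * Real.pi ^ 3 / Real.Gamma (1 / 4) ^ 4) by field_simp; ring,
      Real.log_mul (by positivity) (by positivity), Real.log_mul (by positivity) (by positivity),
      Real.log_pow]
    push_cast
    ring
  rw [sum_summandB2_eq hn, hlog]
  simp only [corr] at h2
  set S := ∑ j ∈ Ico 1 n, rowWeight (Real.pi * j / n)
  set T := ∑ j ∈ Ico 1 n, rowWeight (Real.pi * j / n) *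
    (2 * rowRatio (Real.pi * j / n) ^ n / (1 - rowRatio (Real.pi * j / n) ^ n))
  set S₀ := 2 * n / Real.pi * (Real.log n + Real.eulerMascheroniConstant +
    Real.log (2 / Real.pi)) + n / Real.pi * Real.log (3 / 2) with hS₀
  set T₀ := 4 * n / Real.pi * expSeries with hT₀
  have e : 2 * ((n : ℝ) ^ 2 - 1) / 9 + 2 / 3 * n * S + 2 / 3 * n * T -
      (4 / (3 * Real.pi) * (n : ℝ) ^ 2 * Real.log n +
        2 / (3 * Real.pi) * (2 * Real.eulerMascheroniConstant + (2 * Real.log (2 / Real.pi) +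
          Real.log (3 / 2) + (4 * expSeries + Real.pi / 3))) * (n : ℝ) ^ 2) =
      -(2 / 9) + 2 / 3 * (n * (S - S₀)) + 2 / 3 * (n * (T - T₀)) := by
    rw [hS₀, hT₀]
    field_simp
    ring
  rw [le_div_iff₀ hn'] at h1 h2
  have h1' : |n * (S - S₀)| ≤ C := by rwa [abs_mul, abs_of_pos hn', mul_comm]
  have h2' : |n * (T - T₀)| ≤ D := by rwa [abs_mul, abs_of_pos hn', mul_comm]
  rw [e, abs_le]
  rw [abs_le] at h1' h2'
  constructor <;> linarith

end LatticeSum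

theorem mainTheorem7 :
    (∀ n : ℕ, 1 ≤ n →
      LatticeSum.F LatticeSum.rootsB2 LatticeSum.stdBasis n =
        ((∑ p ∈ (Finset.range n ×ˢ Finset.range n).erase (0, 0),
          1 / (1 - (1 / 4 : ℝ) *
            (Real.cos (2 * Real.pi * (p.1 : ℝ) / n) + Real.cos (2 * Real.pi * (p.2 : ℝ) / n) +
              Real.cos (2 * Real.pi * ((p.1 : ℝ) - (p.2 : ℝ)) / n) +
              Real.cos (2 * Real.pi * ((p.1 : ℝ) + (p.2 : ℝ)) / n))) : ℝ) : ℂ)) ∧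
    (fun n : ℕ =>
      LatticeSum.F LatticeSum.rootsB2 LatticeSum.stdBasis n -
        ((4 / (3 * Real.pi) * (n : ℝ) ^ 2 * Real.log n +
          2 / (3 * Real.pi) *
            (2 * Real.eulerMascheroniConstant +
              Real.log (96 * Real.pi / Real.Gamma (1 / 4) ^ 4)) * (n : ℝ) ^ 2 : ℝ) : ℂ))
      =O[Filter.atTop] (fun n : ℕ => Real.log (n : ℝ)) := by
  refine ⟨fun n _ => LatticeSum.F_rootsB2_eq n, ?_⟩
  obtain ⟨C, hC⟩ := LatticeSum.exists_abs_sum_summandB2_sub_le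
  refine Asymptotics.IsBigO.of_bound C ?_
  -- From `n = 3 > e` on, `log n ≥ 1`, so the bounded error is `O(log n)`.
  filter_upwards [Filter.eventually_ge_atTop 3] with n hn
  have h := hC n (by omega)
  rw [LatticeSum.F_rootsB2_eq, ← Complex.ofReal_sub, Complex.norm_real, Real.norm_eq_abs]
  have hlog : 1 ≤ Real.log n := by
    rw [Real.le_log_iff_exp_le (by positivity)]
    have : (3 : ℝ) ≤ n := by exact_mod_cast hn
    linarith [Real.exp_one_lt_d9]
  rw [Real.norm_eq_abs, abs_of_pos (a := Real.log n) (by linarith)]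
  have hC0 : 0 ≤ C := (abs_nonneg _).trans h
  exact h.trans (le_mul_of_one_le_right hC0 hlog)
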